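/- Let $\|\cdot\|_2$ be the operator norm on $\mathrm M_2(\mathbb R)$ induced by the Euclidean norm on $\mathbb R^2$. For a Bochner integrable $h:J\to \mathrm M_2(\mathbb R)$ on an interval $J\subset\mathbb R$, the right and left time-ordered exponentials of the measure $\phi=h(\theta)\,\mathrm d\theta|_J$ are $$\exp_{\mathrm R}(\phi)=1+\sum_{k\ge1}\int_{t_1\le\dots\le t_k\in J}h(t_1)\cdots h(t_k)\,\mathrm dt_1\cdots\mathrm dt_k,\qquad \exp_{\mathrm L}(\phi)=1+\sum_{k\ge1}\int_{t_1\ge\dots\ge t_k\in J}h(t_1)\cdots h(t_k)\,\mathrm dt_1\cdots\mathrm dt_k,$$ and $\int\|\phi\|_2=\int_J\|h(\theta)\|_2\,\mathrm d\theta$. The Magnus exponent of $A\in\mathrm M_2(\mathbb R)$ is $\mathrm{MP}(A)=\inf\{\int\|\phi\|_2:\exp_{\mathrm R}(\phi)=A\}$ (the infimum of the empty set being $+\infty$). For $A=\begin{bmatrix}a&b\\c&d\end{bmatrix}\in \mathrm M_2(\mathbb R)$ the chiral disk $\mathrm{CD}(A)\subset\mathbb C$ is the (possibly degenerate) closed disk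 with center $\frac{a+d}2+\frac{c-b}2\mathrm i$ and radius $\sqrt{\left(\frac{a-d}2\right)^2+\left(\frac{b+c}2\right)^2}$. Write $D(0,r)$ and $\bar D(0,r)$ for the open and closed disk of radius $r$ about $0$ in $\mathbb C$, and $\log$ for the principal branch. Let $$\tilde I=\begin{bmatrix}0&-1\\1&0\end{bmatrix},\quad \tilde J=\begin{bmatrix}1&0\\0&-1\end{bmatrix},\quad \tilde K=\begin{bmatrix}0&1\\1&0\end{bmatrix},\quad \tilde{\mathbb K}=\{-\sin\beta\,\tilde J+\cos\beta\,\tilde K:\beta\in[0,2\pi)\}.$$ **Theorem.** Suppose that $\mathrm{CD}(A)\subset\exp D(0,\pi)$. Then $p:=\mathrm{MP}(A)$ is finite, and: 1. $p$ is the least element of $\{\lambda\in[0,\pi):\mathrm{CD}(A)\subset\exp\bar D(0,\lambda)\}$. 2. $p=\sup\{|\log z|:z\in\mathrm{CD}(A)\}$. 3. The infimum that defines $\mathrm{MP}(A)$ is attained by explicit normal forms: there is a real $t$ such that $\mathrm{CD}(A)$ touches $\exp\partial D(0,p)$ at $\mathrm e^{p(\cos t+\mathrm i\sin t)}$ (that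 is, this point belongs to $\mathrm{CD}(A)$), and for every such $t$ there are $p_1,p_2\ge0$ with $p_1+p_2=p$ and $\tilde F\in\tilde{\mathbb K}$ such that, with $S=\frac{\sinh(p_2\cos t)}{\cos t}$ (read as $p_2$ if $\cos t=0$), $$\begin{aligned}A&=\mathrm e^{p_1\cos t}\Bigl(\exp(p\sin t\,\tilde I)\bigl(\cosh(p_2\cos t)\,\mathrm{Id}_2-S\sin t\,\tilde I\bigr)+S\tilde F\Bigr)\\ &=\exp_{\mathrm L}\bigl((p_1\exp(t\tilde I)+p_2\exp(2p\theta\sin t\,\tilde I)\tilde F)\,\mathrm d\theta|_{[-1/2,1/2]}\bigr)\\ &=\exp_{\mathrm L}\bigl(\exp(t\tilde I)\,\mathrm d\theta|_{[0,p_1]}\bigr)\,\exp_{\mathrm L}\bigl(\exp((2\theta-p_1-p_2)\sin t\,\tilde I)\tilde F\,\mathrm d\theta|_{[0,p_2]}\bigr)\\ &=\exp_{\mathrm L}\bigl(\exp((2\theta+p_1-p_2)\sin t\,\tilde I)\tilde F\,\mathrm d\theta|_{[0,p_2]}\bigr)\,\exp_{\mathrm L}\bigl(\exp(t\tilde I)\,\mathrm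 d\theta|_{[0,p_1]}\bigr),\end{aligned}$$ and in each of the last three expressions $\int\|\cdot\|_2$ of the measure (in the last two, the sum over both factors) equals $p=\mathrm{MP}(A)$. -/

import Mathlib

open scoped ENNReal Matrix.Norms.L2Operator

noncomputable section

namespace Magnus

open MeasureTheory

section TimeOrdered

variable {𝔄 : Type*} [NormedRing 𝔄] [NormedSpace ℝ 𝔄]

/-- The time-ordered iterated integral
`∫_{t₁ ≤ ⋯ ≤ t_k ≤ s, tᵢ ∈ J} h(t₁) ⋯ h(t_k) dt₁ ⋯ dt_k`, written by integrating over the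
largest variable last. -/
def rightTerm (J : Set ℝ) (h : ℝ → 𝔄) : ℕ → ℝ → 𝔄
  | 0, _ => 1
  | k + 1, s => ∫ t in J ∩ Set.Iic s, rightTerm J h k t * h t

/-- The same with the factors in the opposite order:
`∫_{s ≥ t₁ ≥ ⋯ ≥ t_k, tᵢ ∈ J} h(t₁) ⋯ h(t_k) dt₁ ⋯ dt_k`. -/
def leftTerm (J : Set ℝ) (h : ℝ → 𝔄) : ℕ → ℝ → 𝔄
  | 0, _ => 1
  | k + 1, s => ∫ t in J ∩ Set.Iic s, h t * leftTerm J h k t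

/-- The right time-ordered exponential of the measure `h(t) dt` restricted to the interval `J`:
`1 + ∑_{k ≥ 1} ∫_{t₁ ≤ ⋯ ≤ t_k ∈ J} h(t₁) ⋯ h(t_k)`. -/
def rexp (J : Set ℝ) (h : ℝ → 𝔄) : 𝔄 :=
  1 + ∑' k : ℕ, ∫ t in J, rightTerm J h k t * h t

/-- The left time-ordered exponential of the measure `h(t) dt` restricted to the interval `J`:
`1 + ∑_{k ≥ 1} ∫_{t₁ ≥ ⋯ ≥ t_k ∈ J} h(t₁) ⋯ h(t_k)`. -/
def lexp (J : Set ℝ) (h : ℝ → 𝔄) : 𝔄 :=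
  1 + ∑' k : ℕ, ∫ t in J, h t * leftTerm J h k t

/-- The total variation `∫ |φ|` of the measure `φ = h(t) dt` on `J`. -/
def variation (J : Set ℝ) (h : ℝ → 𝔄) : ℝ≥0∞ :=
  ∫⁻ t in J, ‖h t‖ₑ

/-- The Magnus exponent: the infimum of the total variations of all measures `h(t) dt`, with `h`
Bochner integrable on an interval `J` of the real line, whose right time-ordered exponential
is `A` (it is `∞` if there is no such measure). -/
def magnusExponent (A : 𝔄) : ℝ≥0∞ :=
  sInf {v | ∃ (J : Set ℝ) (h : ℝ → 𝔄),
    J.OrdConnected ∧ IntegrableOn h J ∧ rexp J h = A ∧ variation J h = v}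

/-- `h(t) dt` on the interval `J` is a minimal Magnus presentation of `A`: its left
time-ordered exponential is `A` and its total variation is the Magnus exponent of `A`. -/
def IsMinimalPresentation (J : Set ℝ) (h : ℝ → 𝔄) (A : 𝔄) : Prop :=
  J.OrdConnected ∧ IntegrableOn h J ∧ lexp J h = A ∧ variation J h = magnusExponent A

end TimeOrdered

/-- The chiral disk of a real `2 × 2` matrix `[a b; c d]`: the closed disk with center
`(a + d)/2 + i (c - b)/2` and radius `√(((a - d)/2)² + ((b + c)/2)²)`. -/
def chiralDisk (A : Matrix (Fin 2) (Fin 2) ℝ) : Set ℂ :=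
  Metric.closedBall ⟨(A 0 0 + A 1 1) / 2, (A 1 0 - A 0 1) / 2⟩
    (Real.sqrt (((A 0 0 - A 1 1) / 2) ^ 2 + ((A 0 1 + A 1 0) / 2) ^ 2))

def matI : Matrix (Fin 2) (Fin 2) ℝ := !![0, -1; 1, 0]

def matJ : Matrix (Fin 2) (Fin 2) ℝ := !![1, 0; 0, -1]

def matK : Matrix (Fin 2) (Fin 2) ℝ := !![0, 1; 1, 0]

/-- The orthogonal conjugates of `matK`. -/
def setK : Set (Matrix (Fin 2) (Fin 2) ℝ) :=
  {F | ∃ β ∈ Set.Ico (0 : ℝ) (2 * Real.pi), F = -Real.sin β • matJ + Real.cos β • matK}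

/-- `exp (x • matI)`, the rotation by the angle `x`. -/
def rot (x : ℝ) : Matrix (Fin 2) (Fin 2) ℝ := NormedSpace.exp (x • matI)

/-- `sinh (q c) / c`, extended continuously by `q` at `c = 0`. -/
def sinhQuot (q c : ℝ) : ℝ := if c = 0 then q else Real.sinh (q * c) / c

/-- The arithmetic normal form with parameters `p₁`, `p₂`, `t`, `F`. -/
def normalForm (p₁ p₂ t : ℝ) (F : Matrix (Fin 2) (Fin 2) ℝ) : Matrix (Fin 2) (Fin 2) ℝ :=
  Real.exp (p₁ * Real.cos t) •
    (rot ((p₁ + p₂) * Real.sin t) *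
        (Real.cosh (p₂ * Real.cos t) • (1 : Matrix (Fin 2) (Fin 2) ℝ)
          - (sinhQuot p₂ (Real.cos t) * Real.sin t) • matI)
      + sinhQuot p₂ (Real.cos t) • F)

/-- The density `p₁ exp(t I) + p₂ exp(2 (p₁ + p₂) θ sin t I) F` of the uniform normal form, to be
taken on `[-1/2, 1/2]`. -/
def uniformDensity (p₁ p₂ t : ℝ) (F : Matrix (Fin 2) (Fin 2) ℝ) (θ : ℝ) :
    Matrix (Fin 2) (Fin 2) ℝ :=
  p₁ • rot t + p₂ • (rot (2 * (p₁ + p₂) * θ * Real.sin t) * F)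

/-- The density of the elliptic (complex exponential) part of the concatenated normal forms,
to be taken on `[0, p₁]`. -/
def ellipticDensity (t : ℝ) (_θ : ℝ) : Matrix (Fin 2) (Fin 2) ℝ := rot t

/-- The density `exp((2 θ + q) sin t I) F` of the hyperbolic part of the concatenated normal
forms, to be taken on `[0, p₂]`. -/
def hyperbolicDensity (q t : ℝ) (F : Matrix (Fin 2) (Fin 2) ℝ) (θ : ℝ) :
    Matrix (Fin 2) (Fin 2) ℝ :=
  rot ((2 * θ + q) * Real.sin t) * F

end Magnus

end

noncomputable section

namespace Magnus

open MeasureTheory Filter Topology Set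

section AbsolutelyContinuous

lemma absolutelyContinuousOnInterval_of_dist_le {X Y : Type*} [PseudoMetricSpace X]
    [PseudoMetricSpace Y] {f : ℝ → X} {V : ℝ → Y} {a b K : ℝ} (hK : 0 ≤ K)
    (hV : AbsolutelyContinuousOnInterval V a b)
    (hf : ∀ x ∈ uIcc a b, ∀ y ∈ uIcc a b, dist (f x) (f y) ≤ K * dist (V x) (V y)) :
    AbsolutelyContinuousOnInterval f a b := by
  rw [absolutelyContinuousOnInterval_iff] at hV ⊢
  intro ε hε
  obtain ⟨δ, hδ, H⟩ := hV (ε / (K + 1)) (by positivity)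
  refine ⟨δ, hδ, fun E hE hlt => ?_⟩
  have h1 := H E hE hlt
  have h2 : ∑ i ∈ Finset.range E.1, dist (f (E.2 i).1) (f (E.2 i).2) ≤
      K * ∑ i ∈ Finset.range E.1, dist (V (E.2 i).1) (V (E.2 i).2) := by
    rw [Finset.mul_sum]
    exact Finset.sum_le_sum fun i hi => hf _ (hE.1 i hi).1 _ (hE.1 i hi).2
  have h3 : 0 ≤ ∑ i ∈ Finset.range E.1, dist (V (E.2 i).1) (V (E.2 i).2) :=
    Finset.sum_nonneg fun _ _ => dist_nonneg
  calc _ ≤ _ := h2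
    _ ≤ (K + 1) * ∑ i ∈ Finset.range E.1, dist (V (E.2 i).1) (V (E.2 i).2) := by nlinarith
    _ < (K + 1) * (ε / (K + 1)) := by gcongr
    _ = ε := by field_simp

variable {E : Type*} [NormedAddCommGroup E] [NormedSpace ℝ E] {g : ℝ → E}

lemma setIntegral_Iic_sub (hg : Integrable g) (x y : ℝ) :
    (∫ t in Iic y, g t) - ∫ t in Iic x, g t = ∫ t in x..y, g t :=
  intervalIntegral.integral_Iic_sub_Iic hg.integrableOn hg.integrableOn

lemma tendsto_setIntegral_Iic_atTop (hg : Integrable g) :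
    Tendsto (fun x => ∫ t in Iic x, g t) atTop (𝓝 (∫ t, g t)) :=
  (aecover_Iic tendsto_id).integral_tendsto_of_countably_generated hg

lemma tendsto_setIntegral_Iic_atBot (hg : Integrable g) :
    Tendsto (fun x => ∫ t in Iic x, g t) atBot (𝓝 0) := by
  have h := intervalIntegral_tendsto_integral_Iic (0 : ℝ) hg.integrableOn (tendsto_id (α := ℝ))
  have h2 := (tendsto_const_nhds (x := ∫ t in Iic (0 : ℝ), g t)).sub h
  rw [sub_self] at h2
  refine h2.congr fun x => ?_
  rw [← setIntegral_Iic_sub hg]; simp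

lemma continuous_setIntegral_Iic (hg : Integrable g) :
    Continuous (fun x => ∫ t in Iic x, g t) := by
  have h := intervalIntegral.continuous_primitive (fun a b => hg.intervalIntegrable) (0 : ℝ)
    (f := g) (μ := volume)
  have h2 := h.const_add (∫ t in Iic (0 : ℝ), g t)
  refine h2.congr fun x => ?_
  rw [← setIntegral_Iic_sub hg]; simp

lemma norm_setIntegral_Iic_le (hg : Integrable g) (x : ℝ) :
    ‖∫ t in Iic x, g t‖ ≤ ∫ t, ‖g t‖ :=
  (norm_integral_le_integral_norm _).trans
    (setIntegral_le_integral hg.norm (Eventually.of_forall fun _ => norm_nonneg _))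

lemma ae_hasDerivAt_setIntegral_Iic [CompleteSpace E] (hg : Integrable g) :
    ∀ᵐ x, HasDerivAt (fun x => ∫ t in Iic x, g t) (g x) x := by
  filter_upwards [LocallyIntegrable.ae_hasDerivAt_integral hg.locallyIntegrable] with x hx
  have h2 := (hx 0).const_add (∫ t in Iic (0 : ℝ), g t)
  convert h2 using 1
  funext y
  rw [← setIntegral_Iic_sub hg]; simp

lemma absolutelyContinuousOnInterval_setIntegral_Iic_real {v : ℝ → ℝ} (hv : Integrable v)
    (a b : ℝ) : AbsolutelyContinuousOnInterval (fun x => ∫ t in Iic x, v t) a b := by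
  refine absolutelyContinuousOnInterval_of_dist_le zero_le_one
    (hv.intervalIntegrable.absolutelyContinuousOnInterval_intervalIntegral
      (left_mem_uIcc (a := a) (b := b))) fun x _ y _ => ?_
  rw [one_mul, dist_eq_norm, dist_eq_norm, setIntegral_Iic_sub hv, ← setIntegral_Iic_sub hv a x,
    ← setIntegral_Iic_sub hv a y, sub_sub_sub_cancel_right, setIntegral_Iic_sub hv]

lemma absolutelyContinuousOnInterval_setIntegral_Iic (hg : Integrable g) (a b : ℝ) :
    AbsolutelyContinuousOnInterval (fun x => ∫ t in Iic x, g t) a b := by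
  refine absolutelyContinuousOnInterval_of_dist_le zero_le_one
    (absolutelyContinuousOnInterval_setIntegral_Iic_real hg.norm a b) fun x _ y _ => ?_
  rw [one_mul, dist_eq_norm, dist_eq_norm, setIntegral_Iic_sub hg, setIntegral_Iic_sub hg.norm]
  exact intervalIntegral.norm_integral_le_abs_integral_norm

lemma setIntegral_Iic_mul_pow_le {v : ℝ → ℝ} (hv : Integrable v) (hv0 : ∀ t, 0 ≤ v t) (k : ℕ)
    (s : ℝ) : ∫ t in Iic s, v t * (∫ r in Iic t, v r) ^ k ≤
      (∫ r in Iic s, v r) ^ (k + 1) / (k + 1) := by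
  set V : ℝ → ℝ := fun t => ∫ r in Iic t, v r with hV
  have hV0 : ∀ t, 0 ≤ V t := fun t => integral_nonneg hv0
  have hVc : Continuous V := continuous_setIntegral_Iic hv
  have hVb : ∀ t, ‖V t ^ k‖ ≤ (∫ t, ‖v t‖) ^ k := fun t => by
    rw [norm_pow]; gcongr; exact norm_setIntegral_Iic_le hv t
  have hint : Integrable fun t => v t * V t ^ k :=
    hv.mul_bdd (hVc.pow k).aestronglyMeasurable (Eventually.of_forall hVb)
  have hac : ∀ a (n : ℕ), AbsolutelyContinuousOnInterval (fun t => V t ^ (n + 1)) a s := by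
    intro a n
    induction n with
    | zero => simpa using absolutelyContinuousOnInterval_setIntegral_Iic_real hv a s
    | succ n ih =>
      have := ih.mul (absolutelyContinuousOnInterval_setIntegral_Iic_real hv a s)
      convert this using 1
      exact funext fun t => pow_succ _ _
  refine le_of_tendsto (intervalIntegral_tendsto_integral_Iic s hint.integrableOn
    (tendsto_id (α := ℝ))) (Eventually.of_forall fun a => ?_)
  have h1 := (hac a k).integral_deriv_eq_sub
  have h2 : ∫ x in a..s, deriv (fun t => V t ^ (k + 1)) x =
      ∫ x in a..s, ((k : ℝ) + 1) * (v x * V x ^ k) := by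
    refine intervalIntegral.integral_congr_ae ?_
    filter_upwards [ae_hasDerivAt_setIntegral_Iic hv] with x hx _
    have := (hx.pow (k + 1)).deriv
    simp only [Nat.add_sub_cancel] at this
    rw [show (fun t => V t ^ (k + 1)) = (fun x => ∫ t in Iic x, v t) ^ (k + 1) from rfl, this]
    push_cast; ring
  rw [h2, intervalIntegral.integral_const_mul] at h1
  have h3 : 0 ≤ V a ^ (k + 1) := pow_nonneg (hV0 a) _
  rw [le_div_iff₀ (by positivity)]
  simp only [id]
  nlinarith

/-- An integrable scalar linear differential equation in integral form is solved by the
exponential of the primitive of its coefficient. -/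
lemma one_add_integral_eq_cexp {g y : ℝ → ℂ} (hg : Integrable g) (hgy : Integrable fun t => g t * y t)
    (hy : ∀ s, y s = 1 + ∫ t in Iic s, g t * y t) :
    1 + ∫ t, g t * y t = Complex.exp (∫ t, g t) := by
  set W : ℝ → ℂ := fun s => ∫ t in Iic s, g t with hW
  have hyac : ∀ a b, AbsolutelyContinuousOnInterval y a b := fun a b => by
    refine absolutelyContinuousOnInterval_of_dist_le zero_le_one
      (absolutelyContinuousOnInterval_setIntegral_Iic hgy a b) fun x _ z _ => ?_
    rw [hy x, hy z, dist_add_left, one_mul]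
  have heac : ∀ a b, AbsolutelyContinuousOnInterval (fun s => Complex.exp (-W s)) a b := fun a b => by
    refine absolutelyContinuousOnInterval_of_dist_le (Real.exp_pos (∫ t, ‖g t‖)).le
      (absolutelyContinuousOnInterval_setIntegral_Iic hg a b) fun x _ z _ => ?_
    have hball : ∀ s, -W s ∈ Metric.closedBall (0 : ℂ) (∫ t, ‖g t‖) := fun s => by
      rw [mem_closedBall_zero_iff, norm_neg]; exact norm_setIntegral_Iic_le hg s
    have := (convex_closedBall (0 : ℂ) (∫ t, ‖g t‖)).norm_image_sub_le_of_norm_hasDerivWithin_le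
      (f := Complex.exp) (f' := Complex.exp) (C := Real.exp (∫ t, ‖g t‖))
      (fun w _ => (Complex.hasDerivAt_exp w).hasDerivWithinAt)
      (fun w hw => by
        rw [Complex.norm_exp]
        exact Real.exp_le_exp.2 ((Complex.re_le_norm w).trans (mem_closedBall_zero_iff.1 hw)))
      (hball z) (hball x)
    rwa [show -W x - -W z = -(W x - W z) by ring, norm_neg, ← dist_eq_norm, ← dist_eq_norm] at this
  have hconst : ∀ a b, y a * Complex.exp (-W a) = y b * Complex.exp (-W b) := fun a b => by
    have hac : AbsolutelyContinuousOnInterval (fun s => y s * Complex.exp (-W s)) a b :=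
      (hyac a b).smul (heac a b)
    obtain ⟨C, hC⟩ := hac.const_of_ae_hasDerivAt_zero (by
      filter_upwards [ae_hasDerivAt_setIntegral_Iic hg, ae_hasDerivAt_setIntegral_Iic hgy]
        with x h1 h2 _
      have h3 : HasDerivAt y (g x * y x) x := by
        have : y = fun s => 1 + ∫ t in Iic s, g t * y t := funext hy
        rw [this]
        simpa only [← hy] using h2.const_add 1
      have h1' : HasDerivAt (fun s => -W s) (-g x) x := h1.neg
      have := h3.mul h1'.cexp
      rwa [show g x * y x * Complex.exp (-W x) + y x * (Complex.exp (-W x) * -g x) = 0 by ring]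
        at this)
    exact (hC a left_mem_uIcc).trans (hC b right_mem_uIcc).symm
  have hlim : ∀ (l : Filter ℝ) (p q : ℂ), Tendsto (fun s => ∫ t in Iic s, g t * y t) l (𝓝 p) →
      Tendsto W l (𝓝 q) → Tendsto (fun s => y s * Complex.exp (-W s)) l
        (𝓝 ((1 + p) * Complex.exp (-q))) := fun l p q hp hq => by
    refine Tendsto.mul ?_ ((Complex.continuous_exp.tendsto _).comp hq.neg)
    exact (hp.const_add 1).congr fun s => (hy s).symm
  have h1 := hlim _ _ _ (tendsto_setIntegral_Iic_atBot hgy) (tendsto_setIntegral_Iic_atBot hg)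
  have h2 := hlim _ _ _ (tendsto_setIntegral_Iic_atTop hgy) (tendsto_setIntegral_Iic_atTop hg)
  have h3 := tendsto_nhds_unique (tendsto_const_nhds.congr fun s => hconst 0 s) h1
  have h4 := tendsto_nhds_unique (tendsto_const_nhds.congr fun s => hconst 0 s) h2
  rw [h3] at h4
  simp only [neg_zero, Complex.exp_zero, add_zero, mul_one] at h4
  rw [Complex.exp_neg, eq_comm, mul_inv_eq_one₀ (Complex.exp_ne_zero _)] at h4
  exact h4

end AbsolutelyContinuous

section Path

variable {𝔄 : Type*} [NormedRing 𝔄] [NormedAlgebra ℝ 𝔄]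

lemma setIntegral_inter_Iic_eq {J : Set ℝ} (hJ : J.OrdConnected) (F : ℝ → 𝔄) (s : ℝ) :
    ∫ t in J ∩ Iic s, F t = ∫ t in Iic s, J.indicator F t := by
  rw [setIntegral_indicator hJ.measurableSet, inter_comm]

lemma leftTerm_spec {J : Set ℝ} {h : ℝ → 𝔄} (hJ : J.OrdConnected) (hh : IntegrableOn h J) (k : ℕ) :
    Continuous (leftTerm J h k) ∧ ∀ s, ‖leftTerm J h k s‖ ≤
      ‖(1 : 𝔄)‖ * ((∫ t in Iic s, ‖J.indicator h t‖) ^ k / k.factorial) := by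
  have hH : Integrable (J.indicator h) := hh.integrable_indicator hJ.measurableSet
  induction k with
  | zero => exact ⟨continuous_const, fun s => by simp [leftTerm]⟩
  | succ k ih =>
    obtain ⟨hc, hb⟩ := ih
    set V : ℝ → ℝ := fun s => ∫ t in Iic s, ‖J.indicator h t‖ with hV
    have hV0 : ∀ t, 0 ≤ V t := fun t => integral_nonneg fun _ => norm_nonneg _
    have hVM : ∀ t, V t ≤ ∫ t, ‖J.indicator h t‖ := fun t =>
      setIntegral_le_integral hH.norm (Eventually.of_forall fun _ => norm_nonneg _)
    have heq : leftTerm J h (k + 1) =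
        fun s => ∫ t in Iic s, J.indicator h t * leftTerm J h k t := by
      funext s
      rw [leftTerm, setIntegral_inter_Iic_eq hJ]
      congr 1; funext t
      rw [indicator_mul_left]
    have hint : Integrable fun t => J.indicator h t * leftTerm J h k t :=
      hH.mul_bdd hc.aestronglyMeasurable (Eventually.of_forall fun t => (hb t).trans
        (mul_le_mul_of_nonneg_left (div_le_div_of_nonneg_right
          (pow_le_pow_left₀ (hV0 t) (hVM t) k) (by positivity)) (norm_nonneg _)))
    refine ⟨heq ▸ continuous_setIntegral_Iic hint, fun s => ?_⟩
    have hVint : Integrable fun t => ‖J.indicator h t‖ * V t ^ k :=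
      hH.norm.mul_bdd ((continuous_setIntegral_Iic hH.norm).pow k).aestronglyMeasurable
        (c := (∫ t, ‖J.indicator h t‖) ^ k) (Eventually.of_forall fun t => by
          rw [norm_pow, Real.norm_of_nonneg (hV0 t)]; exact pow_le_pow_left₀ (hV0 t) (hVM t) k)
    rw [heq]
    calc ‖∫ t in Iic s, J.indicator h t * leftTerm J h k t‖
        ≤ ∫ t in Iic s, ‖J.indicator h t * leftTerm J h k t‖ := norm_integral_le_integral_norm _
      _ ≤ ∫ t in Iic s, (‖(1 : 𝔄)‖ / k.factorial) * (‖J.indicator h t‖ * V t ^ k) := by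
          refine setIntegral_mono hint.norm.integrableOn (hVint.const_mul _).integrableOn
            fun t => (norm_mul_le _ _).trans ?_
          refine (mul_le_mul_of_nonneg_left (hb t) (norm_nonneg _)).trans (le_of_eq ?_)
          ring
      _ = (‖(1 : 𝔄)‖ / k.factorial) * ∫ t in Iic s, ‖J.indicator h t‖ * V t ^ k :=
          integral_const_mul _ _
      _ ≤ (‖(1 : 𝔄)‖ / k.factorial) * (V s ^ (k + 1) / (k + 1)) :=
          mul_le_mul_of_nonneg_left
            (setIntegral_Iic_mul_pow_le hH.norm (fun _ => norm_nonneg _) k s) (by positivity)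
      _ = ‖(1 : 𝔄)‖ * (V s ^ (k + 1) / (k + 1).factorial) := by
          rw [Nat.factorial_succ]; push_cast; field_simp

/-- The left time-ordered exponential is the end value of the solution of the linear integral
equation with coefficient `h`. -/
lemma exists_left_path [CompleteSpace 𝔄] {J : Set ℝ} {h : ℝ → 𝔄} (hJ : J.OrdConnected)
    (hh : IntegrableOn h J) :
    ∃ Y : ℝ → 𝔄, Continuous Y ∧ (∃ C, ∀ s, ‖Y s‖ ≤ C) ∧
      (∀ s, Y s = 1 + ∫ t in Iic s, J.indicator h t * Y t) ∧
      lexp J h = 1 + ∫ t, J.indicator h t * Y t := by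
  have hH : Integrable (J.indicator h) := hh.integrable_indicator hJ.measurableSet
  set M : ℝ := ∫ t, ‖J.indicator h t‖ with hM
  set u : ℕ → ℝ := fun k => ‖(1 : 𝔄)‖ * (M ^ k / k.factorial) with hu
  have hus : Summable u := (Real.summable_pow_div_factorial M).mul_left _
  have hb : ∀ k s, ‖leftTerm J h k s‖ ≤ u k := fun k s => by
    refine ((leftTerm_spec hJ hh k).2 s).trans ?_
    refine mul_le_mul_of_nonneg_left (div_le_div_of_nonneg_right (pow_le_pow_left₀
      (integral_nonneg fun _ => norm_nonneg _) (setIntegral_le_integral hH.norm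
        (Eventually.of_forall fun _ => norm_nonneg _)) k) (by positivity)) (norm_nonneg _)
  have hc : ∀ k, Continuous (leftTerm J h k) := fun k => (leftTerm_spec hJ hh k).1
  have hsum : ∀ s, Summable fun k => leftTerm J h k s := fun s =>
    Summable.of_norm_bounded hus fun k => hb k s
  have hint : ∀ k, Integrable fun t => J.indicator h t * leftTerm J h k t := fun k =>
    hH.mul_bdd (hc k).aestronglyMeasurable (Eventually.of_forall (hb k))
  have hterm : ∀ (S : Set ℝ),
      HasSum (fun k => ∫ t in S, J.indicator h t * leftTerm J h k t)
        (∫ t in S, J.indicator h t * ∑' k, leftTerm J h k t) := fun S => by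
    have h1 := hasSum_integral_of_summable_integral_norm (μ := volume.restrict S)
      (F := fun k t => J.indicator h t * leftTerm J h k t) (fun k => (hint k).integrableOn) (by
        refine Summable.of_nonneg_of_le (fun k => integral_nonneg fun _ => norm_nonneg _)
          (fun k => ?_) (hus.mul_left M)
        calc ∫ t in S, ‖J.indicator h t * leftTerm J h k t‖
            ≤ ∫ t, ‖J.indicator h t * leftTerm J h k t‖ :=
              setIntegral_le_integral (hint k).norm (Eventually.of_forall fun _ => norm_nonneg _)
          _ ≤ ∫ t, ‖J.indicator h t‖ * u k :=
              integral_mono (hint k).norm (hH.norm.mul_const _) fun t =>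
                (norm_mul_le _ _).trans (mul_le_mul_of_nonneg_left (hb k t) (norm_nonneg _))
          _ = M * u k := integral_mul_const _ _)
    have h2 : ∀ t, ∑' k, J.indicator h t * leftTerm J h k t =
        J.indicator h t * ∑' k, leftTerm J h k t := fun t => (hsum t).tsum_mul_left _
    simpa only [h2] using h1
  have hsucc : ∀ k s, leftTerm J h (k + 1) s =
      ∫ t in Iic s, J.indicator h t * leftTerm J h k t := fun k s => by
    rw [leftTerm, setIntegral_inter_Iic_eq hJ]
    congr 1; funext t
    rw [indicator_mul_left]
  refine ⟨fun s => ∑' k, leftTerm J h k s, continuous_tsum hc hus hb,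
    ⟨∑' k, u k, fun s => tsum_of_norm_bounded hus.hasSum fun k => hb k s⟩, fun s => ?_, ?_⟩
  · change ∑' k, leftTerm J h k s = _
    rw [(hsum s).tsum_eq_zero_add]
    simp only [hsucc]
    rw [(hterm _).tsum_eq]
    rfl
  · have h1 := hterm univ
    simp only [Measure.restrict_univ] at h1
    rw [lexp, ← h1.tsum_eq]
    congr 2; funext k
    rw [← integral_indicator hJ.measurableSet]
    congr 1; funext t
    rw [indicator_mul_left]

end Path

section Parts

/-- The complex linear part of a real `2 × 2` matrix acting on `ℂ = ℝ²`. -/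
def linPart (M : Matrix (Fin 2) (Fin 2) ℝ) : ℂ := ⟨(M 0 0 + M 1 1) / 2, (M 1 0 - M 0 1) / 2⟩

/-- The conjugate linear part of a real `2 × 2` matrix acting on `ℂ = ℝ²`. -/
def conjPart (M : Matrix (Fin 2) (Fin 2) ℝ) : ℂ := ⟨(M 0 0 - M 1 1) / 2, (M 0 1 + M 1 0) / 2⟩

variable (M N : Matrix (Fin 2) (Fin 2) ℝ)

lemma chiralDisk_eq : chiralDisk M = Metric.closedBall (linPart M) ‖conjPart M‖ := by
  rw [chiralDisk, linPart, Complex.norm_eq_sqrt_sq_add_sq, conjPart]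

lemma ext_parts {M N : Matrix (Fin 2) (Fin 2) ℝ} (h1 : linPart M = linPart N)
    (h2 : conjPart M = conjPart N) : M = N := by
  simp only [linPart, conjPart, Complex.mk.injEq] at h1 h2
  ext i j
  fin_cases i <;> fin_cases j <;> simp <;> linarith [h1.1, h1.2, h2.1, h2.2]

lemma linPart_mul : linPart (M * N) =
    linPart M * linPart N + conjPart M * (starRingEnd ℂ) (conjPart N) := by
  apply Complex.ext <;> simp [linPart, conjPart, Matrix.mul_apply, Fin.sum_univ_two] <;> ring

lemma conjPart_mul : conjPart (M * N) =
    linPart M * conjPart N + conjPart M * (starRingEnd ℂ) (linPart N) := by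
  apply Complex.ext <;> simp [linPart, conjPart, Matrix.mul_apply, Fin.sum_univ_two] <;> ring

lemma linPart_add : linPart (M + N) = linPart M + linPart N := by
  apply Complex.ext <;> simp [linPart] <;> ring

lemma conjPart_add : conjPart (M + N) = conjPart M + conjPart N := by
  apply Complex.ext <;> simp [conjPart] <;> ring

lemma linPart_sub : linPart (M - N) = linPart M - linPart N := by
  apply Complex.ext <;> simp [linPart] <;> ring

lemma conjPart_sub : conjPart (M - N) = conjPart M - conjPart N := by
  apply Complex.ext <;> simp [conjPart] <;> ring

lemma linPart_smul (r : ℝ) : linPart (r • M) = r * linPart M := by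
  apply Complex.ext <;> simp [linPart] <;> ring

lemma conjPart_smul (r : ℝ) : conjPart (r • M) = r * conjPart M := by
  apply Complex.ext <;> simp [conjPart] <;> ring

lemma linPart_one : linPart 1 = 1 := by
  apply Complex.ext <;> simp [linPart]

lemma conjPart_one : conjPart 1 = 0 := by
  apply Complex.ext <;> simp [conjPart]

lemma linPart_transpose : linPart M.transpose = (starRingEnd ℂ) (linPart M) := by
  apply Complex.ext <;> simp [linPart]; ring

lemma conjPart_transpose : conjPart M.transpose = conjPart M := by
  apply Complex.ext <;> simp [conjPart]; ring

lemma norm_vec_eq (x : EuclideanSpace ℝ (Fin 2)) : ‖x‖ = ‖(⟨x 0, x 1⟩ : ℂ)‖ := by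
  rw [EuclideanSpace.norm_eq, Complex.norm_eq_sqrt_sq_add_sq]
  simp [Fin.sum_univ_two]

lemma mulVec_eq (x : EuclideanSpace ℝ (Fin 2)) :
    (⟨(M.mulVec x.ofLp) 0, (M.mulVec x.ofLp) 1⟩ : ℂ) =
      linPart M * ⟨x 0, x 1⟩ + conjPart M * (starRingEnd ℂ) ⟨x 0, x 1⟩ := by
  apply Complex.ext <;>
    simp [linPart, conjPart, Matrix.mulVec, dotProduct, Fin.sum_univ_two] <;> ring

lemma norm_eq_parts : ‖M‖ = ‖linPart M‖ + ‖conjPart M‖ := by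
  apply le_antisymm
  · rw [Matrix.l2_opNorm_def]
    refine ContinuousLinearMap.opNorm_le_bound _ (by positivity) fun x => ?_
    change ‖(WithLp.toLp 2 (M.mulVec x.ofLp) : EuclideanSpace ℝ (Fin 2))‖ ≤ _
    rw [norm_vec_eq, norm_vec_eq x]
    change ‖(⟨(M.mulVec x.ofLp) 0, (M.mulVec x.ofLp) 1⟩ : ℂ)‖ ≤ _
    rw [mulVec_eq]
    refine (norm_add_le _ _).trans (le_of_eq ?_)
    rw [norm_mul, norm_mul, Complex.norm_conj, add_mul]
  · set a := (linPart M).arg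
    set b := (conjPart M).arg
    set z : ℂ := Complex.exp (((b - a) / 2 : ℝ) * Complex.I) with hz
    have hzn : ‖z‖ = 1 := Complex.norm_exp_ofReal_mul_I _
    have h := M.l2_opNorm_mulVec (WithLp.toLp 2 ![z.re, z.im])
    rw [norm_vec_eq, norm_vec_eq (WithLp.toLp 2 ![z.re, z.im])] at h
    change ‖(⟨(M.mulVec (WithLp.toLp 2 ![z.re, z.im] : EuclideanSpace ℝ (Fin 2)).ofLp) 0,
      (M.mulVec (WithLp.toLp 2 ![z.re, z.im] : EuclideanSpace ℝ (Fin 2)).ofLp) 1⟩ : ℂ)‖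
      ≤ ‖M‖ * ‖(⟨z.re, z.im⟩ : ℂ)‖ at h
    rw [mulVec_eq] at h
    simp only [Matrix.cons_val_zero, Matrix.cons_val_one, Complex.eta, hzn, mul_one] at h
    refine le_trans (le_of_eq ?_) h
    have h1 : linPart M * z =
        (‖linPart M‖ : ℂ) * Complex.exp (((b + a) / 2 : ℝ) * Complex.I) := by
      conv_lhs => rw [← Complex.norm_mul_exp_arg_mul_I (linPart M)]
      rw [mul_assoc, hz, ← Complex.exp_add]
      congr 2
      push_cast; ring
    have h2 : conjPart M * (starRingEnd ℂ) z =
        (‖conjPart M‖ : ℂ) * Complex.exp (((b + a) / 2 : ℝ) * Complex.I) := by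
      conv_lhs => rw [← Complex.norm_mul_exp_arg_mul_I (conjPart M)]
      rw [mul_assoc, hz, ← Complex.exp_conj, ← Complex.exp_add]
      congr 2
      simp only [map_mul, Complex.conj_I, Complex.conj_ofReal]
      push_cast; ring
    rw [h1, h2, ← add_mul, norm_mul, Complex.norm_exp_ofReal_mul_I, mul_one,
      ← Complex.ofReal_add, Complex.norm_real, Real.norm_of_nonneg (by positivity)]

/-- For a unit `u`, a point of the boundary of the chiral disk. -/
def diskPoint (u : ℂ) : Matrix (Fin 2) (Fin 2) ℝ →L[ℝ] ℂ :=
  LinearMap.toContinuousLinearMap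
    { toFun := fun M => linPart M + conjPart M * u
      map_add' := fun M N => by rw [linPart_add, conjPart_add]; ring
      map_smul' := fun r M => by
        rw [linPart_smul, conjPart_smul, Complex.real_smul]; simp only [RingHom.id_apply]; ring }

lemma diskPoint_apply (u : ℂ) : diskPoint u M = linPart M + conjPart M * u := rfl

lemma diskPoint_mul {u : ℂ} (hu : ‖u‖ = 1) : diskPoint u (M * N) =
    linPart M * diskPoint u N + conjPart M * u * (starRingEnd ℂ) (diskPoint u N) := by
  have h : u * (starRingEnd ℂ) u = 1 := by
    rw [Complex.mul_conj, Complex.normSq_eq_norm_sq, hu]; simp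
  simp only [diskPoint_apply, linPart_mul, conjPart_mul, map_add, map_mul]
  linear_combination (-conjPart M * (starRingEnd ℂ) (conjPart N)) * h

end Parts

section Transpose

lemma transpose_integral {S : Set ℝ} (F : ℝ → Matrix (Fin 2) (Fin 2) ℝ) :
    (∫ t in S, F t).transpose = ∫ t in S, (F t).transpose :=
  ((Matrix.transposeLinearEquiv (Fin 2) (Fin 2) ℝ ℝ).toContinuousLinearEquiv.integral_comp_comm
    F).symm

lemma transpose_rightTerm (J : Set ℝ) (h : ℝ → Matrix (Fin 2) (Fin 2) ℝ) (k : ℕ) (s : ℝ) :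
    (rightTerm J h k s).transpose = leftTerm J (fun t => (h t).transpose) k s := by
  induction k generalizing s with
  | zero => simp [rightTerm, leftTerm]
  | succ k ih =>
    rw [rightTerm, leftTerm, transpose_integral]
    simp only [Matrix.transpose_mul, ih]

lemma transpose_rexp (J : Set ℝ) (h : ℝ → Matrix (Fin 2) (Fin 2) ℝ) :
    (rexp J h).transpose = lexp J (fun t => (h t).transpose) := by
  rw [rexp, lexp, Matrix.transpose_add, Matrix.transpose_one]
  congr 1
  have := (Matrix.transposeLinearEquiv (Fin 2) (Fin 2) ℝ ℝ).toContinuousLinearEquiv.map_tsum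
    (L := .unconditional ℕ) (f := fun k : ℕ => ∫ t in J, rightTerm J h k t * h t)
  refine this.trans ?_
  congr 1; funext k
  refine (transpose_integral _).trans ?_
  simp only [Matrix.transpose_mul, transpose_rightTerm]

lemma norm_transpose (M : Matrix (Fin 2) (Fin 2) ℝ) : ‖M.transpose‖ = ‖M‖ := by
  rw [norm_eq_parts, norm_eq_parts, linPart_transpose, conjPart_transpose, Complex.norm_conj]

lemma integrableOn_transpose {J : Set ℝ} {h : ℝ → Matrix (Fin 2) (Fin 2) ℝ}
    (hh : IntegrableOn h J) : IntegrableOn (fun t => (h t).transpose) J :=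
  ((Matrix.transposeLinearEquiv (Fin 2) (Fin 2) ℝ
    ℝ).toContinuousLinearEquiv.toContinuousLinearMap).integrable_comp hh

end Transpose

section LowerBound

lemma exists_diskPoint_lexp_eq_exp {J : Set ℝ} {h : ℝ → Matrix (Fin 2) (Fin 2) ℝ}
    (hJ : J.OrdConnected) (hh : IntegrableOn h J) {u : ℂ} (hu : ‖u‖ = 1) :
    ∃ w : ℂ, ‖w‖ ≤ ∫ t in J, ‖h t‖ ∧ diskPoint u (lexp J h) = Complex.exp w := by
  obtain ⟨Y, hYc, ⟨C, hC⟩, hY, hYe⟩ := exists_left_path hJ hh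
  set H := J.indicator h with hHdef
  have hH : Integrable H := hh.integrable_indicator hJ.measurableSet
  have hHY : Integrable fun t => H t * Y t :=
    hH.mul_bdd hYc.aestronglyMeasurable (Eventually.of_forall hC)
  set y : ℝ → ℂ := fun t => diskPoint u (Y t) with hy
  have hyc : Continuous y := (diskPoint u).continuous.comp hYc
  set g : ℝ → ℂ := fun t => diskPoint u (H t * Y t) / y t with hg
  have hgle : ∀ t, ‖diskPoint u (H t * Y t)‖ ≤ ‖H t‖ * ‖y t‖ := fun t => by
    rw [diskPoint_mul _ _ hu, norm_eq_parts, add_mul]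
    refine (norm_add_le _ _).trans (le_of_eq ?_)
    rw [norm_mul, norm_mul, norm_mul, hu, Complex.norm_conj, mul_one]
  have hgn : ∀ t, ‖g t‖ ≤ ‖H t‖ := fun t => by
    rw [hg, norm_div]
    exact div_le_of_le_mul₀ (norm_nonneg _) (norm_nonneg _) (hgle t)
  have hgy : ∀ t, g t * y t = diskPoint u (H t * Y t) := fun t => by
    rcases eq_or_ne (y t) 0 with h0 | h0
    · have := hgle t
      rw [h0, norm_zero, mul_zero, norm_le_zero_iff] at this
      rw [this, h0, mul_zero]
    · exact div_mul_cancel₀ _ h0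
  have hint : Integrable fun t => diskPoint u (H t * Y t) := (diskPoint u).integrable_comp hHY
  have hgint : Integrable g :=
    hH.norm.mono' (hint.aestronglyMeasurable.div₀ hyc.aestronglyMeasurable)
      (Eventually.of_forall hgn)
  have h1 : diskPoint u 1 = 1 := by rw [diskPoint_apply, linPart_one, conjPart_one]; ring
  have key := one_add_integral_eq_cexp (y := y) hgint (by simpa only [hgy] using hint) fun s => by
    simp only [hgy]
    rw [(diskPoint u).integral_comp_comm hHY.integrableOn, ← h1, ← map_add, ← hY s]
  refine ⟨∫ t, g t, ?_, ?_⟩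
  · calc ‖∫ t, g t‖ ≤ ∫ t, ‖g t‖ := norm_integral_le_integral_norm _
      _ ≤ ∫ t, ‖H t‖ := integral_mono hgint.norm hH.norm hgn
      _ = ∫ t in J, ‖h t‖ := by
          rw [← integral_indicator hJ.measurableSet]
          simp only [hHdef, norm_indicator_eq_indicator_norm]
  · rw [← key, hYe, map_add, h1]
    simp only [hgy]
    rw [(diskPoint u).integral_comp_comm hHY]

lemma im_bounds {w : ℂ} (hw : ‖w‖ < Real.pi) : -Real.pi < w.im ∧ w.im < Real.pi :=
  abs_lt.1 ((Complex.abs_im_le_norm w).trans_lt hw)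

lemma log_exp_of_norm_lt {w : ℂ} (hw : ‖w‖ < Real.pi) : Complex.log (Complex.exp w) = w :=
  Complex.log_exp (im_bounds hw).1 (im_bounds hw).2.le

lemma exp_mem_slitPlane_of_norm_lt {w : ℂ} (hw : ‖w‖ < Real.pi) :
    Complex.exp w ∈ Complex.slitPlane := by
  rw [Complex.mem_slitPlane_iff_arg]
  refine ⟨?_, Complex.exp_ne_zero w⟩
  rw [← Complex.log_im, log_exp_of_norm_lt hw]
  exact (im_bounds hw).2.ne

/-- If the boundary of a disk lies in `exp` of the closed disk of radius `v < π` about `0`, then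
so does the whole disk. -/
lemma closedBall_log_le {c : ℂ} {r v : ℝ} (hr : 0 ≤ r) (hv : v < Real.pi)
    (hs : ∀ z ∈ Metric.sphere c r, ∃ w : ℂ, ‖w‖ ≤ v ∧ z = Complex.exp w) :
    ∀ z ∈ Metric.closedBall c r, z ∈ Complex.slitPlane ∧ ‖Complex.log z‖ ≤ v := by
  have hs' : ∀ z ∈ Metric.sphere c r, z ∈ Complex.slitPlane ∧ ‖Complex.log z‖ ≤ v := by
    intro z hz
    obtain ⟨w, hw, rfl⟩ := hs z hz
    rw [log_exp_of_norm_lt (hw.trans_lt hv)]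
    exact ⟨exp_mem_slitPlane_of_norm_lt (hw.trans_lt hv), hw⟩
  have hslit : ∀ z ∈ Metric.closedBall c r, z ∈ Complex.slitPlane := by
    intro z hz
    by_contra hn
    have hcont : Continuous fun T : ℝ => ‖z - T - c‖ := by fun_prop
    have h0 : ‖z - (0 : ℝ) - c‖ ≤ r := by
      simpa [dist_eq_norm] using hz
    have h1 : r ≤ ‖z - ((2 * r : ℝ) : ℂ) - c‖ := by
      have h2 : ‖((2 * r : ℝ) : ℂ)‖ = 2 * r := by
        rw [Complex.norm_real, Real.norm_of_nonneg (by positivity)]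
      have h3 : ‖z - c‖ ≤ r := by simpa [dist_eq_norm] using hz
      have h4 : ((2 * r : ℝ) : ℂ) = (z - c) - (z - ((2 * r : ℝ) : ℂ) - c) := by ring
      have h5 := norm_sub_le (z - c) (z - ((2 * r : ℝ) : ℂ) - c)
      rw [← h4, h2] at h5
      linarith
    obtain ⟨T, hT, hTe⟩ := intermediate_value_Icc (by positivity : (0 : ℝ) ≤ 2 * r)
      hcont.continuousOn ⟨h0, h1⟩
    have hmem : z - T ∈ Metric.sphere c r := by
      rw [mem_sphere_iff_norm]; exact hTe
    have h6 := (hs' _ hmem).1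
    rw [Complex.mem_slitPlane_iff] at h6 hn
    push Not at hn
    rcases h6 with h6 | h6
    · simp at h6; linarith [hT.1]
    · simp at h6; exact h6 hn.2
  refine fun z hz => ⟨hslit z hz, ?_⟩
  rcases hr.eq_or_lt with rfl | hr'
  · exact (hs' z (by simpa using hz)).2
  · refine Complex.norm_le_of_forall_mem_frontier_norm_le (U := Metric.ball c r)
      Metric.isBounded_ball ⟨?_, ?_⟩ ?_ ?_
    · exact fun x hx => (Complex.differentiableAt_log (hslit x
        (Metric.ball_subset_closedBall hx))).differentiableWithinAt
    · rw [closure_ball c hr'.ne']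
      exact fun x hx => (continuousAt_clog (hslit x hx)).continuousWithinAt
    · rw [frontier_ball c hr'.ne']
      exact fun x hx => (hs' x hx).2
    · rwa [closure_ball c hr'.ne']

lemma norm_log_le_of_rexp_eq {J : Set ℝ} {h : ℝ → Matrix (Fin 2) (Fin 2) ℝ}
    {A : Matrix (Fin 2) (Fin 2) ℝ} (hJ : J.OrdConnected) (hh : IntegrableOn h J)
    (hA : rexp J h = A) (hv : ∫ t in J, ‖h t‖ < Real.pi) :
    ∀ z ∈ chiralDisk A, ‖Complex.log z‖ ≤ ∫ t in J, ‖h t‖ := by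
  have hT := transpose_rexp J h
  rw [hA] at hT
  have key : ∀ z ∈ Metric.sphere (linPart A) ‖conjPart A‖,
      ∃ w : ℂ, ‖w‖ ≤ ∫ t in J, ‖h t‖ ∧ z = Complex.exp w := by
    intro z hz
    rw [mem_sphere_iff_norm] at hz
    obtain ⟨u, hu, hzu⟩ : ∃ u : ℂ, ‖u‖ = 1 ∧
        diskPoint u A.transpose = (starRingEnd ℂ) z := by
      simp only [diskPoint_apply, linPart_transpose, conjPart_transpose]
      rcases eq_or_ne (conjPart A) 0 with h0 | h0
      · refine ⟨1, by simp, ?_⟩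
        rw [h0, norm_zero, norm_eq_zero, sub_eq_zero] at hz
        rw [h0, hz]; ring
      · refine ⟨(starRingEnd ℂ) (z - linPart A) / conjPart A, ?_, ?_⟩
        · rw [norm_div, Complex.norm_conj, hz, div_self (norm_ne_zero_iff.2 h0)]
        · rw [mul_div_cancel₀ _ h0, map_sub]; ring
    obtain ⟨w, hw, hwe⟩ := exists_diskPoint_lexp_eq_exp hJ (integrableOn_transpose hh) hu
    simp only [norm_transpose] at hw
    refine ⟨(starRingEnd ℂ) w, by rwa [Complex.norm_conj], ?_⟩
    rw [Complex.exp_conj, ← hwe, ← hT, hzu, Complex.conj_conj]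
  intro z hz
  rw [chiralDisk_eq] at hz
  exact (closedBall_log_le (norm_nonneg _) hv key z hz).2

/-- The Magnus exponent is bounded below by the logarithms of the points of the chiral disk. -/
lemma ofReal_norm_log_le_magnusExponent {A : Matrix (Fin 2) (Fin 2) ℝ} {z : ℂ}
    (hz : z ∈ chiralDisk A) (hlog : ‖Complex.log z‖ < Real.pi) :
    ENNReal.ofReal ‖Complex.log z‖ ≤ magnusExponent A := by
  refine le_sInf ?_
  rintro v ⟨J, h, hJ, hh, hA, rfl⟩
  have hvar : variation J h = ENNReal.ofReal (∫ t in J, ‖h t‖) :=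
    (ofReal_integral_norm_eq_lintegral_enorm hh).symm
  rw [hvar]
  refine ENNReal.ofReal_le_ofReal ?_
  by_cases hv : ∫ t in J, ‖h t‖ < Real.pi
  · exact norm_log_le_of_rexp_eq hJ hh hA hv z hz
  · exact hlog.le.trans (not_lt.1 hv)

end LowerBound

section Evaluation

lemma lexp_Icc_eq_of_hasDerivAt {𝔄 : Type*} [NormedRing 𝔄] [NormedAlgebra ℝ 𝔄] [CompleteSpace 𝔄]
    {a b : ℝ} (hab : a ≤ b) {h U : ℝ → 𝔄} (hc : Continuous h)
    (hU : ∀ t, HasDerivAt U (h t * U t) t) (hUa : U a = 1) : lexp (Icc a b) h = U b := by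
  obtain ⟨Y, hYc, -, hY, hYe⟩ := exists_left_path (J := Icc a b) ordConnected_Icc
    hc.continuousOn.integrableOn_Icc
  have hhY : Continuous fun t => h t * Y t := hc.mul hYc
  set Z : ℝ → 𝔄 := fun s => 1 + ∫ t in a..s, h t * Y t with hZ
  have hZd : ∀ s, HasDerivAt Z (h s * Y s) s := fun s =>
    (intervalIntegral.integral_hasDerivAt_right (hhY.intervalIntegrable _ _)
      (hhY.stronglyMeasurableAtFilter _ _) hhY.continuousAt).const_add 1
  have hind : ∀ S : Set ℝ, ∫ t in S, (Icc a b).indicator h t * Y t =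
      ∫ t in S ∩ Icc a b, h t * Y t := fun S => by
    rw [← setIntegral_indicator measurableSet_Icc]
    congr 1; funext t
    rw [indicator_mul_left]
  have hYZ : ∀ s ∈ Icc a b, Y s = Z s := fun s hs => by
    have : Iic s ∩ Icc a b = Icc a s := by
      ext x; simp only [mem_inter_iff, mem_Iic, mem_Icc]
      exact ⟨fun hx => ⟨hx.2.1, hx.1⟩, fun hx => ⟨hx.2, hx.1, hx.2.trans hs.2⟩⟩
    rw [hY s, hind, this, integral_Icc_eq_integral_Ioc, ← intervalIntegral.integral_of_le hs.1]
  obtain ⟨K, hK⟩ := isCompact_Icc.exists_bound_of_continuousOn (hc.continuousOn (s := Icc a b))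
  have huniq := ODE_solution_unique_of_mem_Icc_right (v := fun t x => h t * x)
    (s := fun _ => univ) (K := K.toNNReal) (f := Z) (g := U) (a := a) (b := b)
    (fun t ht => by
      refine LipschitzOnWith.of_dist_le_mul fun x _ y _ => ?_
      rw [dist_eq_norm, dist_eq_norm, ← mul_sub]
      refine (norm_mul_le _ _).trans (mul_le_mul_of_nonneg_right ?_ (norm_nonneg _))
      exact (hK t (Ico_subset_Icc_self ht)).trans (Real.le_coe_toNNReal K))
    (fun s _ => (hZd s).continuousAt.continuousWithinAt)
    (fun s hs => by
      have := (hZd s).hasDerivWithinAt (s := Ici s)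
      rwa [hYZ s (Ico_subset_Icc_self hs)] at this)
    (fun _ _ => mem_univ _)
    (fun s _ => (hU s).continuousAt.continuousWithinAt)
    (fun s _ => (hU s).hasDerivWithinAt)
    (fun _ _ => mem_univ _) (by simp [hZ, hUa])
  rw [← huniq (right_mem_Icc.2 hab), hYe, hZ, ← setIntegral_univ, hind, univ_inter,
    integral_Icc_eq_integral_Ioc, ← intervalIntegral.integral_of_le hab]

/-- The real matrix with given linear and conjugate linear parts. -/
def ofParts (a b : ℂ) : Matrix (Fin 2) (Fin 2) ℝ :=
  !![a.re + b.re, b.im - a.im; a.im + b.im, a.re - b.re]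

@[simp] lemma linPart_ofParts (a b : ℂ) : linPart (ofParts a b) = a := by
  apply Complex.ext <;> simp [linPart, ofParts]; ring

@[simp] lemma conjPart_ofParts (a b : ℂ) : conjPart (ofParts a b) = b := by
  apply Complex.ext <;> simp [conjPart, ofParts]; ring

/-- `ofParts` as a continuous real linear map. -/
def ofPartsL : ℂ × ℂ →L[ℝ] Matrix (Fin 2) (Fin 2) ℝ :=
  LinearMap.toContinuousLinearMap
    { toFun := fun p => ofParts p.1 p.2
      map_add' := fun p q => ext_parts
        (by rw [linPart_add]; simp) (by rw [conjPart_add]; simp)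
      map_smul' := fun r p => ext_parts
        (by rw [linPart_smul]; simp) (by rw [conjPart_smul]; simp) }

lemma hasDerivAt_ofParts {u w : ℝ → ℂ} {u' w' : ℂ} {t : ℝ} (hu : HasDerivAt u u' t)
    (hw : HasDerivAt w w' t) :
    HasDerivAt (fun t => ofParts (u t) (w t)) (ofParts u' w') t :=
  ofPartsL.hasFDerivAt.comp_hasDerivAt t (hu.prodMk hw)

lemma continuous_ofParts {u w : ℝ → ℂ} (hu : Continuous u) (hw : Continuous w) :
    Continuous (fun t => ofParts (u t) (w t)) :=
  ofPartsL.continuous.comp (hu.prodMk hw)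

lemma rot_eq (x : ℝ) : rot x = ofParts (Complex.exp (x * Complex.I)) 0 := by
  have hI : matI * matI = -1 := by
    ext i j; fin_cases i <;> fin_cases j <;> simp [matI]
  have h1 : ∀ z : ℂ, Complex.liftAux matI hI z = ofParts z 0 := fun z => by
    rw [Complex.liftAux_apply]
    ext i j; fin_cases i <;> fin_cases j <;>
      simp [matI, ofParts, Algebra.algebraMap_eq_smul_one]
  have hc : Continuous (Complex.liftAux matI hI) :=
    (Complex.liftAux matI hI).toLinearMap.continuous_of_finiteDimensional
  have h2 := NormedSpace.map_exp (Complex.liftAux matI hI) hc (x * Complex.I)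
  rw [← Complex.exp_eq_exp_ℂ, h1] at h2
  rw [h2, rot, h1]
  congr 1
  ext i j; fin_cases i <;> fin_cases j <;> simp [matI, ofParts]

@[simp] lemma linPart_rot (x : ℝ) : linPart (rot x) = Complex.exp (x * Complex.I) := by
  rw [rot_eq, linPart_ofParts]

@[simp] lemma conjPart_rot (x : ℝ) : conjPart (rot x) = 0 := by
  rw [rot_eq, conjPart_ofParts]

lemma linPart_matI : linPart matI = Complex.I := by
  apply Complex.ext <;> simp [linPart, matI]

lemma conjPart_matI : conjPart matI = 0 := by
  apply Complex.ext <;> simp [conjPart, matI]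

lemma hasDerivAt_sinhQuot (c q : ℝ) :
    HasDerivAt (fun q => sinhQuot q c) (Real.cosh (q * c)) q := by
  rcases eq_or_ne c 0 with rfl | hc
  · simpa [sinhQuot] using hasDerivAt_id' q
  · simp only [sinhQuot, if_neg hc]
    have h1 : HasDerivAt (fun q : ℝ => q * c) c q := by simpa using (hasDerivAt_id q).mul_const c
    have := (h1.sinh).div_const c
    rwa [mul_div_assoc, div_self hc, mul_one] at this

lemma mul_sinhQuot (c q : ℝ) : c * sinhQuot q c = Real.sinh (q * c) := by
  rcases eq_or_ne c 0 with rfl | hc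
  · simp
  · simp only [sinhQuot, if_neg hc]; field_simp

lemma sinhQuot_zero (c : ℝ) : sinhQuot 0 c = 0 := by simp [sinhQuot]

/-- The common shape of the densities of the normal forms. -/
def density (a b t κ : ℝ) (f : ℂ) (θ : ℝ) : Matrix (Fin 2) (Fin 2) ℝ :=
  ofParts (a * Complex.exp (t * Complex.I))
    (b * Complex.exp ((2 * ((a + b) * Real.sin t * θ + κ) : ℝ) * Complex.I) * f)

lemma continuous_density (a b t κ : ℝ) (f : ℂ) : Continuous (density a b t κ f) :=
  continuous_ofParts continuous_const (by fun_prop)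

lemma norm_density {a b : ℝ} (ha : 0 ≤ a) (hb : 0 ≤ b) (t κ : ℝ) {f : ℂ} (hf : ‖f‖ = 1) (θ : ℝ) :
    ‖density a b t κ f θ‖ = a + b := by
  rw [norm_eq_parts, density, linPart_ofParts, conjPart_ofParts, norm_mul, norm_mul, norm_mul,
    Complex.norm_exp_ofReal_mul_I, Complex.norm_exp_ofReal_mul_I, hf, mul_one, mul_one, mul_one,
    Complex.norm_real, Complex.norm_real, Real.norm_of_nonneg ha, Real.norm_of_nonneg hb]

lemma variation_density {a b : ℝ} (ha : 0 ≤ a) (hb : 0 ≤ b) (t κ : ℝ) {f : ℂ} (hf : ‖f‖ = 1)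
    (θ₀ θ₁ : ℝ) :
    variation (Icc θ₀ θ₁) (density a b t κ f) = ENNReal.ofReal ((a + b) * (θ₁ - θ₀)) := by
  have h : ∀ θ, ‖density a b t κ f θ‖ₑ = ENNReal.ofReal (a + b) := fun θ => by
    rw [← ofReal_norm, norm_density ha hb t κ hf]
  simp only [variation, h]
  rw [setLIntegral_const, Real.volume_Icc, ENNReal.ofReal_mul (by positivity)]

lemma lexp_density (a b t κ : ℝ) {f : ℂ} (hf : ‖f‖ = 1) {θ₀ θ₁ : ℝ} (hθ : θ₀ ≤ θ₁) :
    lexp (Icc θ₀ θ₁) (density a b t κ f) = ofParts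
      (Complex.exp ((a * Real.cos t * (θ₁ - θ₀) : ℝ) +
        ((a + b) * Real.sin t * (θ₁ - θ₀) : ℝ) * Complex.I) *
        (Real.cosh (b * (θ₁ - θ₀) * Real.cos t) -
          sinhQuot (b * (θ₁ - θ₀)) (Real.cos t) * Real.sin t * Complex.I))
      (Complex.exp ((a * Real.cos t * (θ₁ - θ₀) : ℝ) +
        ((a + b) * Real.sin t * (θ₁ + θ₀) + 2 * κ : ℝ) * Complex.I) *
        sinhQuot (b * (θ₁ - θ₀)) (Real.cos t) * f) := by
  set c := Real.cos t with hc
  set s := Real.sin t with hs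
  have hcs : (s : ℂ) ^ 2 + (c : ℂ) ^ 2 = 1 := by
    rw [hs, hc]; exact_mod_cast Real.sin_sq_add_cos_sq t
  have hff : f * (starRingEnd ℂ) f = 1 := by
    rw [Complex.mul_conj, Complex.normSq_eq_norm_sq, hf]; simp
  have hlin : ∀ (x y θ : ℝ), HasDerivAt (fun θ : ℝ => ((x * (θ + y) : ℝ) : ℂ)) (x : ℂ) θ :=
    fun x y θ => by
      have : HasDerivAt (fun θ : ℝ => x * (θ + y)) x θ := by
        simpa using ((hasDerivAt_id θ).add_const y).const_mul x
      exact this.ofReal_comp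
  have hbl : ∀ θ : ℝ, HasDerivAt (fun θ : ℝ => b * (θ - θ₀)) b θ := fun θ => by
    simpa using ((hasDerivAt_id θ).sub_const θ₀).const_mul b
  have hC : ∀ θ : ℝ, HasDerivAt (fun θ : ℝ => ((Real.cosh (b * (θ - θ₀) * c) : ℝ) : ℂ))
      (b * c * (c * sinhQuot (b * (θ - θ₀)) c) : ℂ) θ := fun θ => by
    have := ((hbl θ).mul_const c).cosh.ofReal_comp
    rw [← mul_sinhQuot] at this
    exact this.congr_deriv (by push_cast; ring)
  have hS : ∀ θ : ℝ, HasDerivAt (fun θ : ℝ => ((sinhQuot (b * (θ - θ₀)) c : ℝ) : ℂ))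
      (Real.cosh (b * (θ - θ₀) * c) * b : ℂ) θ := fun θ => by
    have := ((hasDerivAt_sinhQuot c (b * (θ - θ₀))).comp θ (hbl θ)).ofReal_comp
    exact this.congr_deriv (by push_cast; ring)
  have hE : ∀ (x y θ : ℝ), HasDerivAt (fun θ : ℝ => Complex.exp ((a * c * (θ - θ₀) : ℝ) +
      (x * (θ + y) : ℝ) * Complex.I)) (Complex.exp ((a * c * (θ - θ₀) : ℝ) +
      (x * (θ + y) : ℝ) * Complex.I) * (a * c + x * Complex.I)) θ := fun x y θ => by
    have h1 := hlin (a * c) (-θ₀) θ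
    simp only [← sub_eq_add_neg] at h1
    have := (h1.add ((hlin x y θ).mul_const Complex.I)).cexp
    exact this.congr_deriv (by simp only [Pi.add_apply]; push_cast; ring)
  set U : ℝ → Matrix (Fin 2) (Fin 2) ℝ := fun θ => ofParts
      (Complex.exp ((a * c * (θ - θ₀) : ℝ) + ((a + b) * s * (θ - θ₀) : ℝ) * Complex.I) *
        (Real.cosh (b * (θ - θ₀) * c) - sinhQuot (b * (θ - θ₀)) c * s * Complex.I))
      (Complex.exp ((a * c * (θ - θ₀) : ℝ) +
        ((a + b) * s * (θ + θ₀) + 2 * κ : ℝ) * Complex.I) * sinhQuot (b * (θ - θ₀)) c * f) with hU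
  refine lexp_Icc_eq_of_hasDerivAt hθ (continuous_density a b t κ f) (U := U) (fun θ => ?_) ?_
  · have h1 := (hE ((a + b) * s) (-θ₀) θ).mul
      ((hC θ).sub (((hS θ).mul_const (s : ℂ)).mul_const Complex.I))
    simp only [← sub_eq_add_neg] at h1
    have h2 : HasDerivAt (fun θ : ℝ => Complex.exp ((a * c * (θ - θ₀) : ℝ) +
        ((a + b) * s * (θ + θ₀) + 2 * κ : ℝ) * Complex.I) * sinhQuot (b * (θ - θ₀)) c * f)
        ((Complex.exp ((a * c * (θ - θ₀) : ℝ) +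
        ((a + b) * s * (θ + θ₀) + 2 * κ : ℝ) * Complex.I) * (a * c + (a + b) * s * Complex.I) *
          sinhQuot (b * (θ - θ₀)) c + Complex.exp ((a * c * (θ - θ₀) : ℝ) +
        ((a + b) * s * (θ + θ₀) + 2 * κ : ℝ) * Complex.I) *
          (Real.cosh (b * (θ - θ₀) * c) * b)) * f) θ := by
      have h3 := (((hE ((a + b) * s) θ₀ θ).mul_const
        (Complex.exp ((2 * κ : ℝ) * Complex.I))).mul (hS θ)).mul_const f
      have h4 : ∀ θ : ℝ, Complex.exp ((a * c * (θ - θ₀) : ℝ) +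
          ((a + b) * s * (θ + θ₀) + 2 * κ : ℝ) * Complex.I) = Complex.exp ((a * c * (θ - θ₀) : ℝ) +
          ((a + b) * s * (θ + θ₀) : ℝ) * Complex.I) * Complex.exp ((2 * κ : ℝ) * Complex.I) := by
        intro θ
        rw [← Complex.exp_add]
        congr 1
        push_cast; ring
      simp only [h4]
      exact h3.congr_deriv (by push_cast; ring)
    have h5 := hasDerivAt_ofParts h1 h2
    refine h5.congr_deriv ?_
    simp only [Pi.sub_apply]
    set S := sinhQuot (b * (θ - θ₀)) c
    set C := Real.cosh (b * (θ - θ₀) * c)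
    have hx : ∀ (p q : ℝ), (starRingEnd ℂ) (Complex.exp ((p : ℝ) + (q : ℝ) * Complex.I)) =
        Complex.exp ((p : ℝ) + (-q : ℝ) * Complex.I) := fun p q => by
      rw [← Complex.exp_conj]; simp
    have ht : Complex.exp (t * Complex.I) = c + s * Complex.I := by
      rw [Complex.exp_mul_I, hc, hs]; push_cast; rfl
    have hI := Complex.I_sq
    have hUθ : U θ = ofParts
      (Complex.exp ((a * c * (θ - θ₀) : ℝ) + ((a + b) * s * (θ - θ₀) : ℝ) * Complex.I) *
        (C - S * s * Complex.I))
      (Complex.exp ((a * c * (θ - θ₀) : ℝ) +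
        ((a + b) * s * (θ + θ₀) + 2 * κ : ℝ) * Complex.I) * S * f) := rfl
    rw [hUθ]
    clear_value S C
    apply ext_parts
    · rw [linPart_mul]
      simp only [density, linPart_ofParts, conjPart_ofParts, map_mul, hx, Complex.conj_ofReal]
      have h6 : Complex.exp ((2 * ((a + b) * Real.sin t * θ + κ) : ℝ) * Complex.I) *
          Complex.exp ((a * c * (θ - θ₀) : ℝ) +
            (-((a + b) * s * (θ + θ₀) + 2 * κ) : ℝ) * Complex.I) =
          Complex.exp ((a * c * (θ - θ₀) : ℝ) + ((a + b) * s * (θ - θ₀) : ℝ) * Complex.I) := by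
        rw [← Complex.exp_add]
        congr 1
        rw [← hs]; push_cast; ring
      rw [ht]
      set E1 := Complex.exp ((a * c * (θ - θ₀) : ℝ) + ((a + b) * s * (θ - θ₀) : ℝ) * Complex.I)
      clear_value E1
      push_cast
      push_cast at h6
      linear_combination (-(b * S * f * (starRingEnd ℂ) f)) * h6 - (b * S * E1) * hff
        + (b * S * E1) * hcs - (b * S * s ^ 2 * E1) * hI
    · rw [conjPart_mul]
      simp only [density, linPart_ofParts, conjPart_ofParts, map_mul, hx, Complex.conj_ofReal,
        map_sub, Complex.conj_I]
      have h6 : Complex.exp ((2 * ((a + b) * Real.sin t * θ + κ) : ℝ) * Complex.I) *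
          Complex.exp ((a * c * (θ - θ₀) : ℝ) +
            (-((a + b) * s * (θ - θ₀)) : ℝ) * Complex.I) =
          Complex.exp ((a * c * (θ - θ₀) : ℝ) +
            ((a + b) * s * (θ + θ₀) + 2 * κ : ℝ) * Complex.I) := by
        rw [← Complex.exp_add]
        congr 1
        rw [← hs]; push_cast; ring
      rw [ht]
      set E1 := Complex.exp ((a * c * (θ - θ₀) : ℝ) +
            ((a + b) * s * (θ + θ₀) + 2 * κ : ℝ) * Complex.I)
      clear_value E1
      push_cast
      push_cast at h6
      linear_combination (-(b * f * (C + S * s * Complex.I))) * h6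
  · rw [hU]
    apply ext_parts
    · simp [linPart_one, sinhQuot_zero]
    · simp [conjPart_one, sinhQuot_zero]

end Evaluation

section NormalForms

variable {F : Matrix (Fin 2) (Fin 2) ℝ}

lemma linPart_of_mem_setK (hF : F ∈ setK) : linPart F = 0 := by
  obtain ⟨β, -, rfl⟩ := hF
  apply Complex.ext <;> simp [linPart, matJ, matK]

lemma conjPart_matJ_add_matK (β : ℝ) :
    conjPart (-Real.sin β • matJ + Real.cos β • matK) = ⟨-Real.sin β, Real.cos β⟩ := by
  apply Complex.ext <;> simp [conjPart, matJ, matK]; ring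

lemma norm_conjPart_of_mem_setK (hF : F ∈ setK) : ‖conjPart F‖ = 1 := by
  obtain ⟨β, -, rfl⟩ := hF
  rw [conjPart_matJ_add_matK, Complex.norm_eq_sqrt_sq_add_sq]
  simp

lemma exists_mem_setK {f : ℂ} (hf : ‖f‖ = 1) : ∃ F ∈ setK, conjPart F = f := by
  have h := Complex.norm_mul_exp_arg_mul_I (f / Complex.I)
  have hn : ‖f / Complex.I‖ = 1 := by simp [hf]
  rw [hn, Complex.ofReal_one, one_mul, eq_div_iff Complex.I_ne_zero] at h
  obtain ⟨β, hβ, hβe⟩ : ∃ β ∈ Ico (0 : ℝ) (2 * Real.pi),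
      Complex.exp (β * Complex.I) * Complex.I = f := by
    rcases le_or_gt 0 (f / Complex.I).arg with h0 | h0
    · exact ⟨_, ⟨h0, (Complex.arg_le_pi _).trans_lt (by linarith [Real.pi_pos])⟩, h⟩
    · refine ⟨(f / Complex.I).arg + 2 * Real.pi,
        ⟨by linarith [Complex.neg_pi_lt_arg (f / Complex.I), Real.pi_pos], by linarith⟩, ?_⟩
      refine Eq.trans ?_ h
      congr 1
      push_cast
      rw [add_mul, Complex.exp_add, Complex.exp_two_pi_mul_I, mul_one]
  refine ⟨_, ⟨β, hβ, rfl⟩, ?_⟩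
  rw [← hβe, Complex.exp_mul_I, ← Complex.ofReal_cos, ← Complex.ofReal_sin,
    conjPart_matJ_add_matK]
  apply Complex.ext <;>
    simp only [Complex.mul_re, Complex.mul_im, Complex.add_re, Complex.add_im, Complex.ofReal_re,
      Complex.ofReal_im, Complex.I_re, Complex.I_im] <;> ring

lemma normalForm_eq (hF : F ∈ setK) (p₁ p₂ t : ℝ) :
    normalForm p₁ p₂ t F = ofParts
      (Complex.exp ((p₁ * Real.cos t : ℝ) + ((p₁ + p₂) * Real.sin t : ℝ) * Complex.I) *
        (Real.cosh (p₂ * Real.cos t) - sinhQuot p₂ (Real.cos t) * Real.sin t * Complex.I))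
      (Complex.exp ((p₁ * Real.cos t : ℝ)) * sinhQuot p₂ (Real.cos t) * conjPart F) := by
  apply ext_parts
  · simp only [normalForm, linPart_smul, linPart_add, linPart_mul, linPart_sub, linPart_one,
      linPart_matI, linPart_rot, conjPart_rot, linPart_of_mem_setK hF, linPart_ofParts,
      Complex.exp_add]
    push_cast; ring
  · simp only [normalForm, conjPart_smul, conjPart_add, conjPart_mul, conjPart_sub, conjPart_one,
      conjPart_matI, linPart_rot, conjPart_rot, conjPart_ofParts]
    push_cast; ring

lemma uniformDensity_eq (hF : F ∈ setK) (p₁ p₂ t : ℝ) :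
    uniformDensity p₁ p₂ t F = density p₁ p₂ t 0 (conjPart F) := by
  funext θ
  apply ext_parts
  · simp [uniformDensity, density, linPart_add, linPart_smul, linPart_mul,
      linPart_of_mem_setK hF]
  · simp only [uniformDensity, density, conjPart_add, conjPart_smul, conjPart_mul,
      linPart_rot, conjPart_rot, conjPart_ofParts, zero_mul, add_zero, mul_zero, zero_add]
    rw [show 2 * (p₁ + p₂) * θ * Real.sin t = 2 * ((p₁ + p₂) * Real.sin t * θ) by ring, ← mul_assoc (p₂ : ℂ)]

lemma ellipticDensity_eq (t : ℝ) : ellipticDensity t = density 1 0 t 0 1 := by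
  funext θ
  apply ext_parts <;> simp [ellipticDensity, density]

lemma hyperbolicDensity_eq (hF : F ∈ setK) (q t : ℝ) :
    hyperbolicDensity q t F = density 0 1 t (q * Real.sin t / 2) (conjPart F) := by
  funext θ
  apply ext_parts
  · simp [hyperbolicDensity, density, linPart_mul, linPart_of_mem_setK hF]
  · simp only [hyperbolicDensity, density, conjPart_mul,
      linPart_rot, conjPart_rot, conjPart_ofParts, zero_mul, add_zero, zero_add]
    rw [Complex.ofReal_one, one_mul]
    congr 3
    push_cast; ring

lemma lexp_uniformDensity (hF : F ∈ setK) (p₁ p₂ t : ℝ) :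
    lexp (Icc (-1 / 2) (1 / 2)) (uniformDensity p₁ p₂ t F) = normalForm p₁ p₂ t F := by
  rw [uniformDensity_eq hF, lexp_density _ _ _ _ (norm_conjPart_of_mem_setK hF) (by norm_num),
    normalForm_eq hF]
  norm_num

lemma lexp_ellipticDensity {p₁ : ℝ} (hp : 0 ≤ p₁) (t : ℝ) :
    lexp (Icc 0 p₁) (ellipticDensity t) =
      ofParts (Complex.exp ((p₁ * Real.cos t : ℝ) + (p₁ * Real.sin t : ℝ) * Complex.I)) 0 := by
  rw [ellipticDensity_eq, lexp_density _ _ _ _ (by simp) hp]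
  simp [sinhQuot_zero, mul_comm]

lemma lexp_hyperbolicDensity (hF : F ∈ setK) {p₂ : ℝ} (hp : 0 ≤ p₂) (q t : ℝ) :
    lexp (Icc 0 p₂) (hyperbolicDensity q t F) = ofParts
      (Complex.exp ((p₂ * Real.sin t : ℝ) * Complex.I) *
        (Real.cosh (p₂ * Real.cos t) - sinhQuot p₂ (Real.cos t) * Real.sin t * Complex.I))
      (Complex.exp (((p₂ + q) * Real.sin t : ℝ) * Complex.I) *
        sinhQuot p₂ (Real.cos t) * conjPart F) := by
  rw [hyperbolicDensity_eq hF, lexp_density _ _ _ _ (norm_conjPart_of_mem_setK hF) hp]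
  congr 1
  · simp [mul_comm]
  · simp only [sub_zero, one_mul, zero_mul, Complex.ofReal_zero, zero_add, add_zero]
    congr 4
    push_cast; ring

lemma lexp_elliptic_mul_hyperbolic (hF : F ∈ setK) {p₁ p₂ : ℝ} (h₁ : 0 ≤ p₁) (h₂ : 0 ≤ p₂)
    (t : ℝ) : lexp (Icc 0 p₁) (ellipticDensity t) *
      lexp (Icc 0 p₂) (hyperbolicDensity (-p₁ - p₂) t F) = normalForm p₁ p₂ t F := by
  rw [lexp_ellipticDensity h₁, lexp_hyperbolicDensity hF h₂, normalForm_eq hF]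
  apply ext_parts
  · simp only [linPart_mul, linPart_ofParts, conjPart_ofParts, zero_mul, add_zero]
    rw [← mul_assoc, ← Complex.exp_add]
    congr 2
    push_cast; ring
  · simp only [conjPart_mul, linPart_ofParts, conjPart_ofParts, zero_mul, add_zero]
    rw [← mul_assoc, ← mul_assoc, ← Complex.exp_add]
    congr 3
    push_cast; ring

lemma lexp_hyperbolic_mul_elliptic (hF : F ∈ setK) {p₁ p₂ : ℝ} (h₁ : 0 ≤ p₁) (h₂ : 0 ≤ p₂)
    (t : ℝ) : lexp (Icc 0 p₂) (hyperbolicDensity (p₁ - p₂) t F) *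
      lexp (Icc 0 p₁) (ellipticDensity t) = normalForm p₁ p₂ t F := by
  rw [lexp_ellipticDensity h₁, lexp_hyperbolicDensity hF h₂, normalForm_eq hF]
  apply ext_parts
  · simp only [linPart_mul, linPart_ofParts, conjPart_ofParts, map_zero, mul_zero, add_zero]
    rw [mul_right_comm, ← Complex.exp_add]
    congr 2
    push_cast; ring
  · simp only [conjPart_mul, linPart_ofParts, conjPart_ofParts, mul_zero, zero_add]
    have h : Complex.exp (((p₂ + (p₁ - p₂)) * Real.sin t : ℝ) * Complex.I) *
        (starRingEnd ℂ) (Complex.exp ((p₁ * Real.cos t : ℝ) + (p₁ * Real.sin t : ℝ) * Complex.I)) =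
        Complex.exp ((p₁ * Real.cos t : ℝ)) := by
      rw [← Complex.exp_conj, ← Complex.exp_add]
      simp only [map_add, map_mul, Complex.conj_ofReal, Complex.conj_I]
      congr 1
      push_cast; ring
    linear_combination (sinhQuot p₂ (Real.cos t) * conjPart F) * h

lemma rexp_uniformDensity_neg (hF : F ∈ setK) (p₁ p₂ t : ℝ) :
    rexp (Icc (-1 / 2) (1 / 2)) (fun θ => uniformDensity p₁ p₂ t F (-θ)) =
      normalForm p₁ p₂ t F := by
  have h : (fun θ => (uniformDensity p₁ p₂ t F (-θ)).transpose) =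
      uniformDensity p₁ p₂ (-t) F := by
    funext θ
    rw [uniformDensity_eq hF, uniformDensity_eq hF]
    apply ext_parts
    · simp only [density, linPart_transpose, linPart_ofParts, map_mul, Complex.conj_ofReal,
        ← Complex.exp_conj, Complex.conj_I, Complex.ofReal_neg]
      ring_nf
    · simp only [density, conjPart_transpose, conjPart_ofParts, Real.sin_neg]
      ring_nf
  rw [← Matrix.transpose_inj, transpose_rexp, h, lexp_uniformDensity hF, normalForm_eq hF,
    normalForm_eq hF]
  apply ext_parts
  · simp only [linPart_transpose, linPart_ofParts, map_mul, ← Complex.exp_conj, map_add,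
      Complex.conj_ofReal, Complex.conj_I, map_sub, Real.sin_neg, Real.cos_neg]
    push_cast
    ring_nf
  · simp only [conjPart_transpose, conjPart_ofParts, Real.cos_neg]

lemma magnusExponent_normalForm_le (hF : F ∈ setK) {p₁ p₂ : ℝ} (h₁ : 0 ≤ p₁) (h₂ : 0 ≤ p₂)
    (t : ℝ) : magnusExponent (normalForm p₁ p₂ t F) ≤ ENNReal.ofReal (p₁ + p₂) := by
  refine sInf_le ⟨Icc (-1 / 2) (1 / 2), fun θ => uniformDensity p₁ p₂ t F (-θ), ordConnected_Icc,
    ?_, rexp_uniformDensity_neg hF p₁ p₂ t, ?_⟩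
  · rw [uniformDensity_eq hF]
    exact ((continuous_density _ _ _ _ _).comp continuous_neg).continuousOn.integrableOn_Icc
  · have h : ∀ θ, ‖density p₁ p₂ t 0 (conjPart F) (-θ)‖ₑ = ENNReal.ofReal (p₁ + p₂) := fun θ => by
      rw [← ofReal_norm, norm_density h₁ h₂ t 0 (norm_conjPart_of_mem_setK hF)]
    rw [uniformDensity_eq hF]
    simp only [variation, h]
    rw [setLIntegral_const, Real.volume_Icc]
    norm_num

end NormalForms

section Tangency

/-- If a closed disk lies in `exp` of the closed disk of radius `P < π` and touches the boundary
at `exp (P e^{it})`, then its center lies on the inner normal there. -/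
lemma center_eq_of_touching {c₀ : ℂ} {r P t : ℝ} (hr : 0 ≤ r) (hP0 : 0 ≤ P) (hP : P < Real.pi)
    (hball : ∀ z ∈ Metric.closedBall c₀ r, z ∈ Complex.slitPlane ∧ ‖Complex.log z‖ ≤ P)
    (ht : Complex.exp (P * (Real.cos t + Real.sin t * Complex.I)) ∈ Metric.closedBall c₀ r) :
    c₀ = Complex.exp (P * (Real.cos t + Real.sin t * Complex.I)) -
      r * Complex.exp ((P * Real.sin t + t : ℝ) * Complex.I) := by
  set z₀ := Complex.exp (P * (Real.cos t + Real.sin t * Complex.I)) with hz₀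
  set ν := Complex.exp ((P * Real.sin t + t : ℝ) * Complex.I) with hν
  have hνn : ‖ν‖ = 1 := Complex.norm_exp_ofReal_mul_I _
  have hcst : (Real.cos t + Real.sin t * Complex.I : ℂ) = Complex.exp (t * Complex.I) := by
    rw [Complex.exp_mul_I]; push_cast; rfl
  have hw₀n : ‖(P * (Real.cos t + Real.sin t * Complex.I) : ℂ)‖ = P := by
    rw [hcst, norm_mul, Complex.norm_exp_ofReal_mul_I, mul_one, Complex.norm_real,
      Real.norm_of_nonneg hP0]
  have hlog : Complex.log z₀ = P * (Real.cos t + Real.sin t * Complex.I) :=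
    log_exp_of_norm_lt (hw₀n.trans_lt hP)
  have hmem : c₀ + r * ν ∈ Metric.closedBall c₀ r := by
    rw [mem_closedBall_iff_norm, add_sub_cancel_left, norm_mul, hνn, mul_one, Complex.norm_real,
      Real.norm_of_nonneg hr]
  rcases hP0.eq_or_lt with h0 | hPpos
  · have h1 : ∀ z ∈ Metric.closedBall c₀ r, z = 1 := fun z hz => by
      obtain ⟨h2, h3⟩ := hball z hz
      rw [← h0, norm_le_zero_iff] at h3
      rw [← Complex.exp_log (Complex.slitPlane_ne_zero h2), h3, Complex.exp_zero]
    have h2 := h1 _ (Metric.mem_closedBall_self hr)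
    have h3 := h1 _ hmem
    have h4 := h1 _ ht
    rw [h4]
    linear_combination h3
  have hz₀s : z₀ ∈ Complex.slitPlane := (hball _ ht).1
  have hmax : IsLocalMaxOn (fun z : ℂ => ‖Complex.log z‖ ^ 2) (Metric.closedBall c₀ r) z₀ := by
    refine IsMaxOn.localize fun z hz => ?_
    change ‖Complex.log z‖ ^ 2 ≤ ‖Complex.log z₀‖ ^ 2
    rw [hlog, hw₀n]
    exact pow_le_pow_left₀ (norm_nonneg _) (hball z hz).2 2
  have hderiv := hmax.hasFDerivWithinAt_nonpos
    (((Complex.hasDerivAt_log hz₀s).hasFDerivAt.restrictScalars ℝ).norm_sq).hasFDerivWithinAt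
    (sub_mem_posTangentConeAt_of_segment_subset
      ((convex_closedBall c₀ r).segment_subset ht hmem))
  have hre : ((c₀ + r * ν - z₀) * z₀⁻¹ * (starRingEnd ℂ) (Complex.log z₀)).re ≤ 0 := by
    have h2 : 2 * ((c₀ + r * ν - z₀) * z₀⁻¹ * (starRingEnd ℂ) (Complex.log z₀)).re ≤ 0 := by
      simpa [Complex.inner, ← mul_add] using hderiv
    linarith
  have hfac : z₀⁻¹ * (starRingEnd ℂ) (Complex.log z₀) =
      ((P * Real.exp (-(P * Real.cos t)) : ℝ) : ℂ) * (starRingEnd ℂ) ν := by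
    rw [hlog, hcst, map_mul, Complex.conj_ofReal, hν, ← Complex.exp_conj, ← Complex.exp_conj, hz₀,
      ← Complex.exp_neg, Complex.ofReal_mul, Complex.ofReal_exp, mul_left_comm, mul_assoc,
      ← Complex.exp_add, ← Complex.exp_add]
    simp only [map_mul, Complex.conj_ofReal, Complex.conj_I]
    congr 2
    push_cast; ring
  rw [mul_assoc, hfac, mul_left_comm, Complex.re_ofReal_mul] at hre
  have hre2 : ((c₀ + r * ν - z₀) * (starRingEnd ℂ) ν).re ≤ 0 :=
    nonpos_of_mul_nonpos_right hre (by positivity)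
  have hνν : ν * (starRingEnd ℂ) ν = 1 := by
    rw [Complex.mul_conj, Complex.normSq_eq_norm_sq, hνn]; simp
  have hre3 : r ≤ ((z₀ - c₀) * (starRingEnd ℂ) ν).re := by
    have h : (c₀ + r * ν - z₀) * (starRingEnd ℂ) ν =
        (r : ℂ) - (z₀ - c₀) * (starRingEnd ℂ) ν := by
      linear_combination (r : ℂ) * hνν
    rw [h, Complex.sub_re, Complex.ofReal_re] at hre2
    linarith
  have hq : ‖z₀ - c₀‖ ≤ r := mem_closedBall_iff_norm.1 ht
  have hnorm : Complex.normSq (z₀ - c₀ - r * ν) ≤ 0 := by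
    rw [Complex.normSq_sub, map_mul, map_mul, Complex.normSq_eq_norm_sq, Complex.normSq_eq_norm_sq ν,
      hνn, Complex.normSq_ofReal, Complex.conj_ofReal, mul_left_comm, Complex.re_ofReal_mul]
    nlinarith [norm_nonneg (z₀ - c₀)]
  have h0 := Complex.normSq_eq_zero.1 (le_antisymm hnorm (Complex.normSq_nonneg _))
  linear_combination -h0

/-- A disk as in `center_eq_of_touching` is not larger than the disk that touches the boundary
also at the point symmetric to `exp (P e^{it})`. -/
lemma radius_le_of_touching {c₀ : ℂ} {r P t : ℝ} (hr : 0 ≤ r) (hP0 : 0 ≤ P) (hP : P < Real.pi)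
    (hball : ∀ z ∈ Metric.closedBall c₀ r, z ∈ Complex.slitPlane ∧ ‖Complex.log z‖ ≤ P)
    (ht : Complex.exp (P * (Real.cos t + Real.sin t * Complex.I)) ∈ Metric.closedBall c₀ r) :
    r ≤ sinhQuot P (Real.cos t) := by
  have hc₀ := center_eq_of_touching hr hP0 hP hball ht
  have hcst : (Real.cos t + Real.sin t * Complex.I : ℂ) = Complex.exp (t * Complex.I) := by
    rw [Complex.exp_mul_I]; push_cast; rfl
  have key : ∀ w : ℂ, |w.im| < Real.pi → Complex.exp w ∈ Metric.closedBall c₀ r → ‖w‖ ≤ P := by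
    intro w hw hmem
    have h := (hball _ hmem).2
    rwa [Complex.log_exp (abs_lt.1 hw).1 (abs_lt.1 hw).2.le] at h
  set c := Real.cos t with hc
  set s := Real.sin t with hs
  have hcs : s ^ 2 + c ^ 2 = 1 := Real.sin_sq_add_cos_sq t
  have hsplit : ∀ x y : ℝ, Complex.exp (x + (P * s + y : ℝ) * Complex.I) - c₀ =
      Complex.exp ((P * s : ℝ) * Complex.I) * (Real.exp x * Complex.exp (y * Complex.I) -
        Real.exp (P * c) + r * (c + s * Complex.I)) := by
    intro x y
    have e1 : Complex.exp (x + (P * s + y : ℝ) * Complex.I) =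
        Complex.exp ((P * s : ℝ) * Complex.I) * (Real.exp x * Complex.exp (y * Complex.I)) := by
      rw [Complex.ofReal_exp, ← Complex.exp_add, ← Complex.exp_add]
      congr 1
      push_cast; ring
    have e2 : Complex.exp (P * (c + s * Complex.I)) =
        Complex.exp ((P * s : ℝ) * Complex.I) * Real.exp (P * c) := by
      rw [Complex.ofReal_exp, ← Complex.exp_add]
      congr 1
      push_cast; ring
    have e3 : Complex.exp ((P * s + t : ℝ) * Complex.I) =
        Complex.exp ((P * s : ℝ) * Complex.I) * (c + s * Complex.I) := by
      rw [hcst, ← Complex.exp_add]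
      congr 1
      push_cast; ring
    rw [hc₀, e1, e2, e3]
    ring
  have hnormSq : ∀ x y : ℝ, ‖Complex.exp (x + (P * s + y : ℝ) * Complex.I) - c₀‖ ^ 2 =
      (Real.exp x * Real.cos y - Real.exp (P * c) + r * c) ^ 2 +
        (Real.exp x * Real.sin y + r * s) ^ 2 := by
    intro x y
    rw [hsplit, norm_mul, Complex.norm_exp_ofReal_mul_I, one_mul, ← Complex.normSq_eq_norm_sq,
      Complex.exp_mul_I, ← Complex.ofReal_cos, ← Complex.ofReal_sin, Complex.normSq_apply]
    simp only [Complex.add_re, Complex.add_im, Complex.sub_re, Complex.sub_im, Complex.mul_re,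
      Complex.mul_im, Complex.ofReal_re, Complex.ofReal_im, Complex.I_re, Complex.I_im]
    ring
  by_contra! hlt
  have hrpos : 0 < r := by
    refine lt_of_le_of_lt ?_ hlt
    rcases eq_or_ne c 0 with h0 | h0
    · simpa [sinhQuot, h0] using hP0
    · rw [sinhQuot, if_neg h0]
      rcases lt_or_gt_of_ne h0 with h1 | h1
      · exact div_nonneg_of_nonpos (Real.sinh_nonpos_iff.2 (by nlinarith)) h1.le
      · exact div_nonneg (Real.sinh_nonneg_iff.2 (by positivity)) h1.le
  have hPpos : 0 < P := by
    refine hP0.lt_of_ne fun h0 => ?_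
    have h1 : ∀ z ∈ Metric.closedBall c₀ r, z = 1 := fun z hz => by
      obtain ⟨h2, h3⟩ := hball z hz
      rw [← h0, norm_le_zero_iff] at h3
      rw [← Complex.exp_log (Complex.slitPlane_ne_zero h2), h3, Complex.exp_zero]
    have h2 := h1 _ (Metric.mem_closedBall_self hr)
    have h3 := h1 (c₀ + r) (by
      rw [mem_closedBall_iff_norm, add_sub_cancel_left, Complex.norm_real, Real.norm_of_nonneg hr])
    rw [h2] at h3
    simp at h3
    exact hrpos.ne' h3
  rcases eq_or_ne c 0 with h0 | h0
  · rw [sinhQuot, if_pos h0] at hlt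
    have hs1 : s ^ 2 = 1 := by rw [← hcs, h0]; ring
    have hsabs : |s| = 1 := by rw [← sq_eq_sq₀ (abs_nonneg _) zero_le_one, sq_abs, hs1]; ring
    have hd : HasDerivAt (fun δ : ℝ => Real.cos δ + r * Real.sin δ - Real.exp (P * δ)) (r - P) 0 := by
      have := ((Real.hasDerivAt_cos 0).add ((Real.hasDerivAt_sin 0).const_mul r)).sub
        (((hasDerivAt_id' (0 : ℝ)).const_mul P).exp)
      exact this.congr_deriv (by simp)
    have hev := hd.tendsto_slope_zero_right.eventually (lt_mem_nhds (sub_pos.2 hlt))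
    have hev2 : ∀ᶠ δ : ℝ in 𝓝[>] 0, δ < P := nhdsWithin_le_nhds (gt_mem_nhds hPpos)
    obtain ⟨δ, ⟨h1, h2⟩, h3⟩ := ((hev.and hev2).and self_mem_nhdsWithin).exists
    have hδ : 0 < δ := h3
    have h4 : Real.exp (P * δ) < Real.cos δ + r * Real.sin δ := by
      have := mul_pos hδ h1
      rw [smul_eq_mul, mul_inv_cancel_left₀ hδ.ne'] at this
      simpa using this
    set ε := Real.sqrt (2 * P * δ) with hε
    have hε2 : ε ^ 2 = 2 * P * δ := Real.sq_sqrt (by positivity)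
    have h5 : Real.cosh ε < Real.cos δ + r * Real.sin δ := by
      refine (Real.cosh_le_exp_half_sq ε).trans_lt ?_
      rwa [hε2, show 2 * P * δ / 2 = P * δ by ring]
    have hcosh : 2 * Real.cosh ε * Real.exp ε = Real.exp ε ^ 2 + 1 := by
      rw [Real.cosh_eq, Real.exp_neg]; field_simp
    have hmem : Complex.exp (ε + (P * s + -(s * δ) : ℝ) * Complex.I) ∈ Metric.closedBall c₀ r := by
      rw [mem_closedBall_iff_norm, ← sq_le_sq₀ (norm_nonneg _) hr, hnormSq, h0]
      have hcosδ : Real.cos (-(s * δ)) = Real.cos δ := by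
        rw [Real.cos_neg]
        rcases abs_eq zero_le_one |>.1 hsabs with h | h <;> simp [h]
      have hsinδ : Real.sin (-(s * δ)) = -(s * Real.sin δ) := by
        rw [Real.sin_neg]
        rcases abs_eq zero_le_one |>.1 hsabs with h | h <;> simp [h]
      rw [hcosδ, hsinδ]
      have h6 := mul_lt_mul_of_pos_right h5 (Real.exp_pos ε)
      have h7 := Real.sin_sq_add_cos_sq δ
      simp only [mul_zero, Real.exp_zero, add_zero]
      have h8 : (Real.exp ε * Real.cos δ - 1) ^ 2 + (Real.exp ε * -(s * Real.sin δ) + r * s) ^ 2 =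
          Real.exp ε ^ 2 * (Real.sin δ ^ 2 + Real.cos δ ^ 2) + 1 -
            2 * Real.exp ε * (Real.cos δ + r * Real.sin δ) + r ^ 2 := by
        linear_combination (Real.exp ε * Real.sin δ - r) ^ 2 * hs1
      rw [h8, h7]
      linarith
    have him : |((ε : ℂ) + (P * s + -(s * δ) : ℝ) * Complex.I).im| < Real.pi := by
      have : ((ε : ℂ) + (P * s + -(s * δ) : ℝ) * Complex.I).im = s * (P - δ) := by
        simp; ring
      rw [this, abs_mul, hsabs, one_mul, abs_of_pos (sub_pos.2 h2)]
      linarith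
    have h6 := key _ him hmem
    have h7 : ‖(ε : ℂ) + (P * s + -(s * δ) : ℝ) * Complex.I‖ ^ 2 = P ^ 2 + δ ^ 2 := by
      rw [Complex.norm_add_mul_I, Real.sq_sqrt (by positivity), hε2]
      linear_combination (P - δ) ^ 2 * hs1
    have h8 := pow_le_pow_left₀ (norm_nonneg _) h6 2
    rw [h7] at h8
    nlinarith
  · rw [sinhQuot, if_neg h0] at hlt
    have hprod : Real.sinh (P * c) * (Real.sinh (P * c) - r * c) < 0 := by
      rcases lt_or_gt_of_ne h0 with h1 | h1
      · have h2 : Real.sinh (P * c) < 0 := Real.sinh_neg_iff.2 (mul_neg_of_pos_of_neg hPpos h1)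
        rw [div_lt_iff_of_neg h1] at hlt
        exact mul_neg_of_neg_of_pos h2 (sub_pos.2 hlt)
      · have h2 : 0 < Real.sinh (P * c) := Real.sinh_pos_iff.2 (by positivity)
        rw [div_lt_iff₀ h1] at hlt
        exact mul_neg_of_pos_of_neg h2 (sub_neg.2 hlt)
    have hmem : ‖Complex.exp ((-(P * c) : ℝ) + (P * s + 0 : ℝ) * Complex.I) - c₀‖ < r := by
      rw [← sq_lt_sq₀ (norm_nonneg _) hr, hnormSq, Real.cos_zero, Real.sin_zero]
      have h1 : Real.exp (-(P * c)) - Real.exp (P * c) = -(2 * Real.sinh (P * c)) := by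
        rw [Real.sinh_eq]; ring
      rw [mul_one, h1]
      nlinarith
    set w : ℂ := (-(P * c) : ℝ) + (P * s + 0 : ℝ) * Complex.I with hw
    have hwn : ‖w‖ = P := by
      rw [← sq_eq_sq₀ (norm_nonneg _) hP0, hw, Complex.norm_add_mul_I,
        Real.sq_sqrt (by positivity)]
      linear_combination P ^ 2 * hcs
    have hcont : Continuous fun η : ℝ => ‖Complex.exp ((1 + η : ℝ) * w) - c₀‖ := by fun_prop
    have hcont2 : Continuous fun η : ℝ => |(((1 + η : ℝ) : ℂ) * w).im| :=
      (Complex.continuous_im.comp (by fun_prop)).abs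
    have hev1 : ∀ᶠ η : ℝ in 𝓝[>] 0, ‖Complex.exp ((1 + η : ℝ) * w) - c₀‖ < r :=
      nhdsWithin_le_nhds (hcont.continuousAt.eventually_lt_const (by simpa using hmem))
    have hev2 : ∀ᶠ η : ℝ in 𝓝[>] 0, |(((1 + η : ℝ) : ℂ) * w).im| < Real.pi := by
      refine nhdsWithin_le_nhds (hcont2.continuousAt.eventually_lt_const ?_)
      simp only [add_zero, Complex.ofReal_one, one_mul]
      exact (Complex.abs_im_le_norm w).trans_lt (hwn ▸ hP)
    obtain ⟨η, ⟨h1, h2⟩, h3⟩ := ((hev1.and hev2).and self_mem_nhdsWithin).exists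
    have hη : 0 < η := h3
    have h4 := key _ h2 (mem_closedBall_iff_norm.2 h1.le)
    rw [norm_mul, hwn, Complex.norm_real, Real.norm_of_nonneg (by positivity)] at h4
    nlinarith [mul_pos hη hPpos]

end Tangency

section Main

/-- A matrix whose chiral disk touches the boundary of the smallest region at `exp (P e^{it})`
has a normal form with parameter `t`. -/
lemma exists_normalForm {A : Matrix (Fin 2) (Fin 2) ℝ} {P t : ℝ} (hP0 : 0 ≤ P) (hP : P < Real.pi)
    (hball : ∀ z ∈ chiralDisk A, z ∈ Complex.slitPlane ∧ ‖Complex.log z‖ ≤ P)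
    (ht : Complex.exp (P * (Real.cos t + Real.sin t * Complex.I)) ∈ chiralDisk A) :
    ∃ p₁ p₂ : ℝ, 0 ≤ p₁ ∧ 0 ≤ p₂ ∧ p₁ + p₂ = P ∧ ∃ F ∈ setK, A = normalForm p₁ p₂ t F := by
  rw [chiralDisk_eq] at hball ht
  have hc₀ := center_eq_of_touching (norm_nonneg _) hP0 hP hball ht
  have hrad := radius_le_of_touching (norm_nonneg _) hP0 hP hball ht
  have hcont : Continuous fun q : ℝ => Real.exp ((P - q) * Real.cos t) * sinhQuot q (Real.cos t) :=
    (by fun_prop : Continuous fun q : ℝ => Real.exp ((P - q) * Real.cos t)).mul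
      (continuous_iff_continuousAt.2 fun q => (hasDerivAt_sinhQuot (Real.cos t) q).continuousAt)
  obtain ⟨p₂, hp₂, hp₂e⟩ := intermediate_value_Icc hP0 hcont.continuousOn
    (show ‖conjPart A‖ ∈ _ by simpa [sinhQuot_zero] using hrad)
  obtain ⟨f, hf, hfe⟩ : ∃ f : ℂ, ‖f‖ = 1 ∧ conjPart A = ‖conjPart A‖ * f := by
    refine ⟨Complex.exp ((conjPart A).arg * Complex.I), Complex.norm_exp_ofReal_mul_I _, ?_⟩
    rw [Complex.norm_mul_exp_arg_mul_I]
  obtain ⟨F, hF, rfl⟩ := exists_mem_setK hf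
  refine ⟨P - p₂, p₂, sub_nonneg.2 hp₂.2, hp₂.1, by ring, F, hF, ?_⟩
  rw [normalForm_eq hF]
  simp only at hp₂e
  have hcst : (Real.cos t + Real.sin t * Complex.I : ℂ) = Complex.exp (t * Complex.I) := by
    rw [Complex.exp_mul_I]; push_cast; rfl
  apply ext_parts
  · rw [linPart_ofParts, hc₀, ← hp₂e]
    have h1 : Real.exp (P * Real.cos t) = Real.exp ((P - p₂) * Real.cos t) *
        (Real.cosh (p₂ * Real.cos t) + Real.cos t * sinhQuot p₂ (Real.cos t)) := by
      rw [mul_sinhQuot, Real.cosh_add_sinh, ← Real.exp_add]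
      congr 1; ring
    have h2 : Complex.exp (P * (Real.cos t + Real.sin t * Complex.I)) =
        (Real.exp (P * Real.cos t) : ℝ) * Complex.exp ((P * Real.sin t : ℝ) * Complex.I) := by
      rw [Complex.ofReal_exp, ← Complex.exp_add]
      congr 1
      push_cast; ring
    have h3 : Complex.exp ((P * Real.sin t + t : ℝ) * Complex.I) =
        Complex.exp ((P * Real.sin t : ℝ) * Complex.I) * (Real.cos t + Real.sin t * Complex.I) := by
      rw [hcst, ← Complex.exp_add]
      congr 1
      push_cast; ring
    rw [h2, h1, h3, Complex.exp_add, sub_add_cancel, ← Complex.ofReal_exp]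
    simp only [Complex.ofReal_mul, Complex.ofReal_add]
    ring
  · rw [conjPart_ofParts]
    conv_lhs => rw [hfe, ← hp₂e]
    rw [← Complex.ofReal_exp, ← Complex.ofReal_mul]

/-- The density of the uniform normal form is a minimal presentation as soon as the parameters
add up to the Magnus exponent. -/
lemma isMinimalPresentation_uniformDensity {A F : Matrix (Fin 2) (Fin 2) ℝ} (hF : F ∈ setK)
    {p₁ p₂ t : ℝ} (h₁ : 0 ≤ p₁) (h₂ : 0 ≤ p₂) (hA : A = normalForm p₁ p₂ t F)
    (hM : magnusExponent A = ENNReal.ofReal (p₁ + p₂)) :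
    IsMinimalPresentation (Icc (-1 / 2) (1 / 2)) (uniformDensity p₁ p₂ t F) A := by
  refine ⟨ordConnected_Icc, ?_, by rw [lexp_uniformDensity hF, hA], ?_⟩
  · rw [uniformDensity_eq hF]
    exact (continuous_density _ _ _ _ _).continuousOn.integrableOn_Icc
  · rw [uniformDensity_eq hF, variation_density h₁ h₂ _ _ (norm_conjPart_of_mem_setK hF), hM]
    norm_num

lemma variation_ellipticDensity (p t : ℝ) :
    variation (Icc 0 p) (ellipticDensity t) = ENNReal.ofReal p := by
  rw [ellipticDensity_eq, variation_density zero_le_one le_rfl _ _ (by simp)]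
  norm_num

lemma variation_hyperbolicDensity {F : Matrix (Fin 2) (Fin 2) ℝ} (hF : F ∈ setK) (p q t : ℝ) :
    variation (Icc 0 p) (hyperbolicDensity q t F) = ENNReal.ofReal p := by
  rw [hyperbolicDensity_eq hF,
    variation_density le_rfl zero_le_one _ _ (norm_conjPart_of_mem_setK hF)]
  norm_num

end Main

end Magnus

end

theorem mainTheorem9 (A : Matrix (Fin 2) (Fin 2) ℝ)
    (hA : Magnus.chiralDisk A ⊆ Complex.exp '' Metric.ball (0 : ℂ) Real.pi) :
    Magnus.magnusExponent A ≠ ⊤ ∧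
    -- the Magnus exponent is the smallest radius
    IsLeast {r : ℝ | r ∈ Set.Ico 0 Real.pi ∧
        Magnus.chiralDisk A ⊆ Complex.exp '' Metric.closedBall (0 : ℂ) r}
      (Magnus.magnusExponent A).toReal ∧
    -- the Magnus exponent is the supremum of the moduli of the logarithms
    IsLUB ((fun z : ℂ => ‖Complex.log z‖) '' Magnus.chiralDisk A)
      (Magnus.magnusExponent A).toReal ∧
    -- the disk touches the boundary of the smallest region
    (∃ t : ℝ, Complex.exp ((Magnus.magnusExponent A).toReal *
        ((Real.cos t : ℂ) + (Real.sin t : ℂ) * Complex.I)) ∈ Magnus.chiralDisk A) ∧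
    -- for each touching point there are normal forms, and these attain the Magnus exponent
    ∀ t : ℝ, Complex.exp ((Magnus.magnusExponent A).toReal *
        ((Real.cos t : ℂ) + (Real.sin t : ℂ) * Complex.I)) ∈ Magnus.chiralDisk A →
      ∃ p₁ p₂ : ℝ, 0 ≤ p₁ ∧ 0 ≤ p₂ ∧ p₁ + p₂ = (Magnus.magnusExponent A).toReal ∧
      ∃ F ∈ Magnus.setK,
        A = Magnus.normalForm p₁ p₂ t F ∧
        Magnus.IsMinimalPresentation (Set.Icc (-1 / 2) (1 / 2))
          (Magnus.uniformDensity p₁ p₂ t F) A ∧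
        A = Magnus.lexp (Set.Icc 0 p₁) (Magnus.ellipticDensity t) *
            Magnus.lexp (Set.Icc 0 p₂) (Magnus.hyperbolicDensity (-p₁ - p₂) t F) ∧
        A = Magnus.lexp (Set.Icc 0 p₂) (Magnus.hyperbolicDensity (p₁ - p₂) t F) *
            Magnus.lexp (Set.Icc 0 p₁) (Magnus.ellipticDensity t) ∧
        Magnus.variation (Set.Icc 0 p₁) (Magnus.ellipticDensity t) +
            Magnus.variation (Set.Icc 0 p₂) (Magnus.hyperbolicDensity (-p₁ - p₂) t F) =
          Magnus.magnusExponent A ∧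
        Magnus.variation (Set.Icc 0 p₂) (Magnus.hyperbolicDensity (p₁ - p₂) t F) +
            Magnus.variation (Set.Icc 0 p₁) (Magnus.ellipticDensity t) =
          Magnus.magnusExponent A := by
  have hlog : ∀ z ∈ Magnus.chiralDisk A, z ∈ Complex.slitPlane ∧ ‖Complex.log z‖ < Real.pi := by
    intro z hz
    obtain ⟨w, hw, rfl⟩ := hA hz
    rw [mem_ball_zero_iff] at hw
    exact ⟨Magnus.exp_mem_slitPlane_of_norm_lt hw, by rwa [Magnus.log_exp_of_norm_lt hw]⟩
  have hexp : ∀ z ∈ Magnus.chiralDisk A, Complex.exp (Complex.log z) = z := fun z hz =>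
    Complex.exp_log (Complex.slitPlane_ne_zero (hlog z hz).1)
  obtain ⟨m, hm, hmax⟩ := (show IsCompact (Magnus.chiralDisk A) by
      rw [Magnus.chiralDisk_eq]; exact isCompact_closedBall _ _).exists_isMaxOn
    (show (Magnus.chiralDisk A).Nonempty by
      rw [Magnus.chiralDisk_eq]; exact ⟨_, Metric.mem_closedBall_self (norm_nonneg _)⟩)
    (f := fun z => ‖Complex.log z‖)
    (fun z hz => (continuousAt_clog (hlog z hz).1).norm.continuousWithinAt)
  set P := ‖Complex.log m‖ with hPdef
  have hP0 : 0 ≤ P := norm_nonneg _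
  have hP : P < Real.pi := (hlog m hm).2
  have hball : ∀ z ∈ Magnus.chiralDisk A, z ∈ Complex.slitPlane ∧ ‖Complex.log z‖ ≤ P :=
    fun z hz => ⟨(hlog z hz).1, hmax hz⟩
  have htouch : Complex.exp (P * ((Real.cos (Complex.log m).arg : ℂ) +
      (Real.sin (Complex.log m).arg : ℂ) * Complex.I)) ∈ Magnus.chiralDisk A := by
    have h := Complex.norm_mul_exp_arg_mul_I (Complex.log m)
    rw [Complex.exp_mul_I, ← Complex.ofReal_cos, ← Complex.ofReal_sin] at h
    rw [h, hexp m hm]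
    exact hm
  have hM : Magnus.magnusExponent A = ENNReal.ofReal P := by
    refine le_antisymm ?_ (Magnus.ofReal_norm_log_le_magnusExponent hm hP)
    obtain ⟨p₁, p₂, h₁, h₂, hsum, F, hF, hAF⟩ := Magnus.exists_normalForm hP0 hP hball htouch
    rw [hAF, ← hsum]
    exact Magnus.magnusExponent_normalForm_le hF h₁ h₂ _
  have hMr : (Magnus.magnusExponent A).toReal = P := by rw [hM, ENNReal.toReal_ofReal hP0]
  rw [hMr]
  refine ⟨hM ▸ ENNReal.ofReal_ne_top, ⟨⟨⟨hP0, hP⟩, fun z hz => ?_⟩, ?_⟩, ⟨?_, fun b hb => ?_⟩,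
    ⟨_, htouch⟩, fun t ht => ?_⟩
  · exact ⟨Complex.log z, mem_closedBall_zero_iff.2 (hball z hz).2, hexp z hz⟩
  · rintro r ⟨⟨-, hr⟩, hsub⟩
    obtain ⟨w, hw, hwm⟩ := hsub hm
    rw [mem_closedBall_zero_iff] at hw
    rwa [hPdef, ← hwm, Magnus.log_exp_of_norm_lt (hw.trans_lt hr)]
  · rintro _ ⟨z, hz, rfl⟩
    exact (hball z hz).2
  · exact hb ⟨m, hm, rfl⟩
  · obtain ⟨p₁, p₂, h₁, h₂, hsum, F, hF, hAF⟩ := Magnus.exists_normalForm hP0 hP hball ht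
    refine ⟨p₁, p₂, h₁, h₂, hsum, F, hF, hAF,
      Magnus.isMinimalPresentation_uniformDensity hF h₁ h₂ hAF (hM.trans (by rw [hsum])), ?_, ?_,
      ?_, ?_⟩
    · rw [Magnus.lexp_elliptic_mul_hyperbolic hF h₁ h₂, ← hAF]
    · rw [Magnus.lexp_hyperbolic_mul_elliptic hF h₁ h₂, ← hAF]
    · rw [Magnus.variation_ellipticDensity, Magnus.variation_hyperbolicDensity hF,
        ← ENNReal.ofReal_add h₁ h₂, hsum, hM]
    · rw [Magnus.variation_ellipticDensity, Magnus.variation_hyperbolicDensity hF,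
        ← ENNReal.ofReal_add h₂ h₁, add_comm, hsum, hM]
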